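/- Consider one bosonic mode with Hilbert space $H$ and orthonormal basis of Fock states $|0\rangle,|1\rangle,\dots$; let $a,a^\dagger$ be the annihilation and creation operators, $a|n\rangle=\sqrt n\,|n-1\rangle$, and $\hat q=(a+a^\dagger)/\sqrt2$, $\hat p=(a-a^\dagger)/(i\sqrt2)$. For $\beta>0$, $\xi=(\xi_1,\xi_2)\in\mathbb R^2$ and $r,\phi\in\mathbb R$ define the thermal state $\rho_\beta=(1-e^{-\beta})\sum_{n\ge0}e^{-\beta n}|n\rangle\langle n|$, the displacement operator $\mathscr D(\xi)=\exp[i(\xi_2\hat q-\xi_1\hat p)]$, the squeezing operator $\mathscr S(r,\phi)=\exp\big[\tfrac r2\big(e^{-2i\phi}a^2-e^{2i\phi}(a^\dagger)^2\big)\big]$, and the Gaussian state $$\rho(\beta,\xi,r,\phi)=\mathscr D(\xi)^\dagger\,\mathscr S(r,\phi)^\dagger\,\rho_\beta\,\mathscr S(r,\phi)\,\mathscr D(\xi).$$ Let $\rho_0=\rho(\beta,\xi,r_0,\phi_0)$ and $\rho_1=\rho(\beta,\xi,r_1,\phi_1)$ be two such states with the same inverse temperature $\beta>0$ and no relative displacement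 (the same $\xi$; in particular $\xi=0$ is allowed). Put $S_{r,\phi}=O_\phi D_rO_\phi^t$ with $D_r=\mathrm{diag}(e^r,e^{-r})$ and $O_\phi=\begin{pmatrix}\cos\phi&\sin\phi\\-\sin\phi&\cos\phi\end{pmatrix}$. Then for every $s\in[0,1]$ the operator $\rho_0^s\rho_1^{1-s}$ is trace class with real trace $Q_s=\operatorname{tr}\rho_0^s\rho_1^{1-s}$. The minimum of $Q_s$ over $s\in[0,1]$ is attained at $s^*=\tfrac12$, and only there if $\rho_0\ne\rho_1$. There are $R\ge0$ and $\Phi\in\mathbb R$ with $$\big(S_{r_0,\phi_0}^{-1}S_{r_1,\phi_1}\big)\big(S_{r_0,\phi_0}^{-1}S_{r_1,\phi_1}\big)^t=S_{R,\Phi}S_{R,\Phi}^t ,$$ and for all real $R,\Phi$ with this property $$\cosh 2R=\cos^2(\phi_0-\phi_1)\cosh[2(r_0-r_1)]+\sin^2(\phi_0-\phi_1)\cosh[2(r_0+r_1)].$$ The quantum Chernoff quantity $Q=\min_{s\in[0,1]}Q_s$ is $$Q=\frac1{\cosh R}=\big[\cosh^2(r_0-r_1)+\sin^2(\phi_0-\phi_1)\,\sinh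 2r_0\,\sinh 2r_1\big]^{-1/2},$$ which does not depend on $\beta$ (nor on $\xi$). -/

import Mathlib

open scoped Matrix

noncomputable section

namespace GaussianChernoff

/-! ### Ladder and quadrature operators of one mode

The Hilbert space `H` of the mode carries the orthonormal basis `ket` of Fock (number) states
`|0⟩, |1⟩, |2⟩, …`. -/

variable {H : Type*} [NormedAddCommGroup H] [InnerProductSpace ℂ H] [CompleteSpace H]

/-- Finite linear combinations of Fock states, the common domain of the unbounded operators. -/
abbrev FiniteVec : Type := ℕ →₀ ℂ

/-- The inclusion of the finite linear combinations of Fock states into the Hilbert space. -/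
def incl (ket : HilbertBasis ℕ ℂ H) : FiniteVec →ₗ[ℂ] H := Finsupp.linearCombination ℂ ket

/-- The annihilation operator: `a |n⟩ = √n |n - 1⟩` (and `a |0⟩ = 0`). -/
def ann : Module.End ℂ FiniteVec :=
  Finsupp.linearCombination ℂ fun n : ℕ => Finsupp.single (n - 1) ((Real.sqrt n : ℝ) : ℂ)

/-- The creation operator: `a† |n⟩ = √(n + 1) |n + 1⟩`. -/
def cre : Module.End ℂ FiniteVec :=
  Finsupp.linearCombination ℂ fun n : ℕ =>
    Finsupp.single (n + 1) ((Real.sqrt ((n : ℝ) + 1) : ℝ) : ℂ)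

/-- Position, `q = (a + a†) / √2`. -/
def posOp : Module.End ℂ FiniteVec := ((Real.sqrt 2 : ℝ) : ℂ)⁻¹ • (ann + cre)

/-- Momentum, `p = (a - a†) / (i √2)`. -/
def momOp : Module.End ℂ FiniteVec := (Complex.I * ((Real.sqrt 2 : ℝ) : ℂ))⁻¹ • (ann - cre)

/-! ### Exponentials of unbounded skew-symmetric operators -/

/-- `U` is a strongly continuous one-parameter unitary group whose generator extends `K`. -/
structure IsUnitaryGroupOf (ket : HilbertBasis ℕ ℂ H) (K : Module.End ℂ FiniteVec)
    (U : ℝ → H →L[ℂ] H) : Prop where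
  unitary : ∀ t, U t ∈ unitary (H →L[ℂ] H)
  map_zero : U 0 = 1
  map_add : ∀ s t, U (s + t) = U s * U t
  continuous : ∀ ψ : H, Continuous fun t => U t ψ
  hasDerivAt : ∀ v : FiniteVec, HasDerivAt (fun t => U t (incl ket v)) (incl ket (K v)) 0

open Classical in
/-- The unitary operator `exp K`, for `K` essentially skew-adjoint on the finite linear
combinations of Fock states: the value at `t = 1` of the unique strongly continuous unitary group
`t ↦ exp (t K)` generated by the closure of `K`. -/
def opExp (ket : HilbertBasis ℕ ℂ H) (K : Module.End ℂ FiniteVec) : H →L[ℂ] H :=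
  if h : ∃! U, IsUnitaryGroupOf ket K U then h.choose 1 else 1

/-- The squeezing operator `S(r, φ) = exp [(r/2) (e^{-2iφ} a² - e^{2iφ} (a†)²)]`. -/
def squeezeOp (ket : HilbertBasis ℕ ℂ H) (r φ : ℝ) : H →L[ℂ] H :=
  opExp ket (((r / 2 : ℝ) : ℂ) • (Complex.exp (-(2 * φ * Complex.I)) • ann ^ 2
    - Complex.exp (2 * φ * Complex.I) • cre ^ 2))

/-- The displacement operator `D(u) = exp [i (u₂ q - u₁ p)]`, where `u = (u₁, u₂)`. -/
def displaceOp (ket : HilbertBasis ℕ ℂ H) (u : Fin 2 → ℝ) : H →L[ℂ] H :=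
  opExp ket (Complex.I • (((u 1 : ℝ) : ℂ) • posOp - ((u 0 : ℝ) : ℂ) • momOp))

/-! ### Gaussian states -/

/-- The thermal state `ρ_β = (1 - e^{-β}) ∑ₙ e^{-β n} |n⟩⟨n|`. -/
def thermalState (ket : HilbertBasis ℕ ℂ H) (β : ℝ) : H →L[ℂ] H :=
  ∑' n : ℕ, (((1 - Real.exp (-β)) * Real.exp (-β * n) : ℝ) : ℂ) •
    InnerProductSpace.rankOne ℂ (ket n) (ket n)

/-- The single-mode Gaussian state `ρ(β, ξ, r, φ) = D(ξ)† S(r, φ)† ρ_β S(r, φ) D(ξ)`. -/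
def gaussianState (ket : HilbertBasis ℕ ℂ H) (β : ℝ) (ξ : Fin 2 → ℝ) (r φ : ℝ) : H →L[ℂ] H :=
  star (displaceOp ket ξ) * star (squeezeOp ket r φ) * thermalState ket β * squeezeOp ket r φ *
    displaceOp ket ξ

/-! ### Trace and Chernoff quantity -/

/-- On the separable infinite-dimensional `H`, `T` is trace class with trace `z`:
the diagonal of `T` is (absolutely) summable with sum `z` in every orthonormal basis. -/
def HasTrace (T : H →L[ℂ] H) (z : ℂ) : Prop :=
  ∀ b : HilbertBasis ℕ ℂ H, HasSum (fun i => inner ℂ (b i) (T (b i))) z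

/-- The trace, computed in the Fock basis. -/
def trace (ket : HilbertBasis ℕ ℂ H) (T : H →L[ℂ] H) : ℂ := ∑' n : ℕ, inner ℂ (ket n) (T (ket n))

/-- `Q_s = tr (ρ₀^s ρ₁^{1-s})`, with powers from the functional calculus of positive operators. -/
def chernoffQ (ket : HilbertBasis ℕ ℂ H) (ρ₀ ρ₁ : H →L[ℂ] H) (s : ℝ) : ℝ :=
  (trace ket (ρ₀ ^ s * ρ₁ ^ (1 - s))).re

/-- The quantum Chernoff quantity `Q = inf_{s ∈ [0,1]} Q_s`. -/
def quantumChernoff (ket : HilbertBasis ℕ ℂ H) (ρ₀ ρ₁ : H →L[ℂ] H) : ℝ :=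
  sInf (chernoffQ ket ρ₀ ρ₁ '' Set.Icc 0 1)

/-! ### Phase-space matrices -/

/-- `D_r = diag (e^r, e^{-r})`. -/
def diagMat (r : ℝ) : Matrix (Fin 2) (Fin 2) ℝ := !![Real.exp r, 0; 0, Real.exp (-r)]

/-- The rotation `O_φ`. -/
def rotMat (φ : ℝ) : Matrix (Fin 2) (Fin 2) ℝ :=
  !![Real.cos φ, Real.sin φ; -Real.sin φ, Real.cos φ]

/-- The symplectic matrix of squeezing, `S_{r,φ} = O_φ D_r O_φᵗ`. -/
def squeezeMat (r φ : ℝ) : Matrix (Fin 2) (Fin 2) ℝ := rotMat φ * diagMat r * (rotMat φ)ᵀ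

/-- `R, Φ` are the parameters of the relative squeezing:
`(S₀⁻¹ S₁) (S₀⁻¹ S₁)ᵗ = S_{R,Φ} S_{R,Φ}ᵗ`, where `Sᵢ = S_{rᵢ,φᵢ}`. -/
def IsRelativeSqueezing (r₀ φ₀ r₁ φ₁ R Φ : ℝ) : Prop :=
  ((squeezeMat r₀ φ₀)⁻¹ * squeezeMat r₁ φ₁) * ((squeezeMat r₀ φ₀)⁻¹ * squeezeMat r₁ φ₁)ᵀ
    = squeezeMat R Φ * (squeezeMat R Φ)ᵀ

end GaussianChernoff

end

/-!
Both states have the eigenvalues of the thermal state, so that `ρ₀ ^ s` and `ρ₁ ^ (1 - s)` are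
diagonal in the orthonormal bases `D† S₀† |m⟩` and `D† S₁† |n⟩`. The displacement cancels in the
overlaps of these bases, and with `x = e^{-β s}`, `y = e^{-β (1 - s)}` and the transition
probabilities `p m n = |⟨m| S₀ S₁† |n⟩|²` one finds `Q_s = (1 - x y) ∑ p m n xᵐ yⁿ`.

The sum is computed from the way squeezing acts on the ladder operators alone. Two linear
recurrences for the matrix elements, one from `a` and one from `a†`, give by subtraction of their
squared moduli a recurrence for the probabilities (`relProb_rec`), since the interference terms
agree. For the generating function `F` it reads `(1 - x²) F_x + (1 - y²) F_y = (x + y) F`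
(`genFun_pde`). Along the characteristics, where `w = (y - x) / (1 - x y)` is constant, `F` is
determined by its values on `x = 0`; these satisfy an ordinary differential equation
(`relProb_row`, `genFun_ode`), normalized by `∑ₙ p 0 n = 1`. The outcome (`genFun_sq`) is
`Q_s⁻² = P - (P - 1) w²` with `P = cosh² R`, which is largest exactly at `w = 0`, that is `s = 1/2`.

For this the squeezing operators have to be identified. Every Fock state is an analytic vector of
the quadratic generator `K`, because `K` raises the weights `(k + 2) (k + 4) ⋯ (k + 2n)` by one
factor (`hasAnalyticVectors_squeezeGen`). Hence the exponential series defines isometries for small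
times, and these compose to the unitary group (`HasAnalyticVectors.exists_unitaryGroup`). Uniqueness
of the group and the Bogoliubov transformation of `a` and `a†` both follow from Taylor's formula for
families of curves with `d v' = d (K v)` (`eq_zero_of_hasDerivAt_iterate`).

The parameter `R` enters through the trace of the relative covariance matrix, which is `2 cosh 2R`
and agrees with `2 (2 P - 1)` (`IsRelativeSqueezing.cosh_two_mul`). If `P = 1`, then the two
generators coincide and the states are equal (`eq_of_coshSqR_eq_one`).
-/

namespace GaussianChernoff

open Filter Topology
open scoped Matrix InnerProductSpace

noncomputable section

/-! ### Power series of factorial growth and analytic vectors -/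

section Series

open scoped Nat

variable {X : Type*} [NormedAddCommGroup X] [NormedSpace ℝ X]

theorem norm_exp_term_le {k : ℕ → X} {M ρ : ℝ} (hk : ∀ n, ‖k n‖ ≤ M * ρ ^ n * n !) (t : ℝ) (n : ℕ) :
    ‖(t ^ n / n !) • k n‖ ≤ M * (ρ * |t|) ^ n := by
  have hn : (0 : ℝ) < n ! := by positivity
  rw [norm_smul, Real.norm_eq_abs, abs_div, abs_pow, Nat.abs_cast]
  calc |t| ^ n / n ! * ‖k n‖ ≤ |t| ^ n / n ! * (M * ρ ^ n * n !) := by gcongr; exact hk n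
    _ = M * (ρ * |t|) ^ n := by rw [mul_pow]; field_simp

theorem summable_exp_term [CompleteSpace X] {k : ℕ → X} {M ρ : ℝ} (hρ : 0 ≤ ρ)
    (hk : ∀ n, ‖k n‖ ≤ M * ρ ^ n * n !)
    {t : ℝ} (ht : ρ * |t| < 1) : Summable fun n => (t ^ n / n !) • k n :=
  Summable.of_norm_bounded ((summable_geometric_of_lt_one (by positivity) ht).mul_left M)
    (norm_exp_term_le hk t)

theorem sum_antidiagonal_exp_term (s t : ℝ) (n : ℕ) :
    ∑ p ∈ Finset.HasAntidiagonal.antidiagonal n, s ^ p.1 / p.1 ! * (t ^ p.2 / p.2 !) =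
      (s + t) ^ n / n ! := by
  rw [Commute.add_pow' (Commute.all s t), Finset.sum_div]
  refine Finset.sum_congr rfl fun p hp => ?_
  rw [Finset.HasAntidiagonal.mem_antidiagonal] at hp
  subst hp
  have h := Nat.add_choose_mul_factorial_mul_factorial p.1 p.2
  have h' : (((p.1 + p.2).choose p.1 : ℕ) : ℝ) * p.1 ! * p.2 ! = (p.1 + p.2)! := by
    rw [Nat.choose_symm_add]; exact_mod_cast h
  rw [nsmul_eq_mul, ← h']
  have h1 : (((p.1 + p.2).choose p.1 : ℕ) : ℝ) ≠ 0 := by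
    exact_mod_cast (Nat.choose_pos (Nat.le_add_right _ _)).ne'
  field_simp

/-- The law `exp (s K) exp (t K) = exp ((s + t) K)` on the level of power series: the family
`k n` stands for `K ^ n v`, with the growth `M ρⁿ n!` of an analytic vector. -/
theorem exp_double_series [CompleteSpace X] {k : ℕ → X} {M ρ : ℝ} (hρ : 0 ≤ ρ)
    (hk : ∀ n, ‖k n‖ ≤ M * ρ ^ n * n !)
    {s t : ℝ} (hst : ρ * (|s| + |t|) < 1) :
    Summable (fun p : ℕ × ℕ => (s ^ p.1 / p.1 ! * (t ^ p.2 / p.2 !)) • k (p.1 + p.2)) ∧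
      ∑' p : ℕ × ℕ, (s ^ p.1 / p.1 ! * (t ^ p.2 / p.2 !)) • k (p.1 + p.2) =
        ∑' n, ((s + t) ^ n / n !) • k n := by
  let e := Finset.HasAntidiagonal.sigmaAntidiagonalEquivProd (A := ℕ)
  set f : ℕ × ℕ → X := fun p => (s ^ p.1 / p.1 ! * (t ^ p.2 / p.2 !)) • k (p.1 + p.2) with hf
  have hfib : ∀ n (c : Finset.HasAntidiagonal.antidiagonal n), f (e ⟨n, c⟩) =
      (s ^ c.1.1 / c.1.1 ! * (t ^ c.1.2 / c.1.2 !)) • k n := by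
    intro n c
    have hc := Finset.HasAntidiagonal.mem_antidiagonal.1 c.2
    simp only [hf, e, Finset.HasAntidiagonal.sigmaAntidiagonalEquivProd_apply, hc]
  have hM : 0 ≤ M := by simpa using (norm_nonneg _).trans (hk 0)
  have hsum : Summable (f ∘ e) := by
    refine Summable.of_norm ?_
    rw [summable_sigma_of_nonneg fun _ => norm_nonneg _]
    refine ⟨fun n => (hasSum_fintype _).summable, ?_⟩
    refine Summable.of_nonneg_of_le (fun n => tsum_nonneg fun _ => norm_nonneg _) (fun n => ?_)
      ((summable_geometric_of_lt_one (by positivity) hst).mul_left M)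
    rw [tsum_fintype]
    have : ∑ c : Finset.HasAntidiagonal.antidiagonal n, ‖(f ∘ e) ⟨n, c⟩‖ =
        (∑ p ∈ Finset.HasAntidiagonal.antidiagonal n, |s| ^ p.1 / p.1 ! * (|t| ^ p.2 / p.2 !)) *
          ‖k n‖ := by
      rw [Finset.sum_mul, ← Finset.sum_coe_sort (Finset.HasAntidiagonal.antidiagonal n)
        fun p => |s| ^ p.1 / p.1 ! * (|t| ^ p.2 / p.2 !) * ‖k n‖]
      refine Finset.sum_congr rfl fun c _ => ?_
      rw [Function.comp_apply, hfib, norm_smul, norm_mul, Real.norm_eq_abs, Real.norm_eq_abs,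
        abs_div, abs_div, abs_pow, abs_pow, Nat.abs_cast, Nat.abs_cast]
    rw [this, sum_antidiagonal_exp_term]
    have hn : (0 : ℝ) < n ! := by positivity
    calc (|s| + |t|) ^ n / n ! * ‖k n‖ ≤ (|s| + |t|) ^ n / n ! * (M * ρ ^ n * n !) := by
          gcongr; exact hk n
      _ = M * (ρ * (|s| + |t|)) ^ n := by rw [mul_pow]; field_simp
  refine ⟨e.summable_iff.1 hsum, ?_⟩
  rw [← e.tsum_eq]
  change ∑' x, (f ∘ e) x = _
  rw [hsum.tsum_sigma]
  refine tsum_congr fun n => ?_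
  rw [tsum_fintype, ← sum_antidiagonal_exp_term, Finset.sum_smul]
  exact (Finset.sum_congr rfl fun c _ => hfib n c).trans
    (Finset.sum_coe_sort (Finset.HasAntidiagonal.antidiagonal n)
      fun p => (s ^ p.1 / p.1 ! * (t ^ p.2 / p.2 !)) • k n)

end Series

section Uniqueness

open scoped Nat

variable {V E : Type*} [AddCommGroup V] [Module ℂ V] [NormedAddCommGroup E] [NormedSpace ℝ E]

/-- Taylor's estimate for a family of curves with `d v' = d (K v)` vanishing at `a`. -/
theorem norm_le_of_hasDerivAt_iterate (K : Module.End ℂ V) (d : V → ℝ → E)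
    (hd : ∀ v t, HasDerivAt (d v) (d (K v) t) t) {a b C : ℝ} (ha : ∀ v, d v a = 0) (n : ℕ) :
    ∀ v, (∀ t ∈ Set.Icc a b, ‖d ((K ^ n) v) t‖ ≤ C) →
      ∀ t ∈ Set.Icc a b, ‖d v t‖ ≤ C * ((t - a) ^ n / n !) := by
  induction n with
  | zero => intro v h t ht; simpa using h t ht
  | succ n ih =>
    intro v h t ht
    have h1 : ∀ t ∈ Set.Icc a b, ‖d (K v) t‖ ≤ C * ((t - a) ^ n / n !) :=
      ih (K v) fun t ht => by simpa [pow_succ] using h t ht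
    refine image_norm_le_of_norm_deriv_right_le_deriv_boundary (f := d v) (f' := d (K v))
      (B := fun t => C * ((t - a) ^ (n + 1) / (n + 1)!)) (B' := fun t => C * ((t - a) ^ n / n !))
      (fun x _ => (hd v x).continuousAt.continuousWithinAt)
      (fun x _ => (hd v x).hasDerivWithinAt) (by simp [ha]) (fun x => ?_)
      (fun x hx => h1 x (Set.Ico_subset_Icc_self hx)) ht
    have := ((((hasDerivAt_id x).sub_const a).pow (n + 1)).div_const ((n + 1)! : ℝ)).const_mul C
    refine this.congr_deriv ?_
    rw [Nat.factorial_succ]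
    push_cast
    have hn : ((n : ℝ) + 1) ≠ 0 := by positivity
    have hn' : ((n ! : ℕ) : ℝ) ≠ 0 := by positivity
    simp only [id]
    field_simp

/-- A family of curves with `d v' = d (K v)` which vanishes at time `0` vanishes at all later
times, provided the iterates `d (K ^ n v)` grow like those of an analytic vector. -/
theorem eq_zero_of_hasDerivAt_iterate (K : Module.End ℂ V) (d : V → ℝ → E)
    (hd : ∀ v t, HasDerivAt (d v) (d (K v) t) t) (h0 : ∀ v, d v 0 = 0) {ρ : ℝ} (hρ : 0 < ρ)
    (hb : ∀ v T, ∃ M, ∀ n, ∀ t ∈ Set.Icc 0 T, ‖d ((K ^ n) v) t‖ ≤ M * ρ ^ n * n !) :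
    ∀ v t, 0 ≤ t → d v t = 0 := by
  -- steps shorter than the radius of convergence `1 / ρ`
  have step : ∀ a, 0 ≤ a → (∀ v, d v a = 0) → ∀ t, a ≤ t → t ≤ a + (2 * ρ)⁻¹ → ∀ v, d v t = 0 := by
    intro a ha0 ha t hat hta v
    obtain ⟨M, hM⟩ := hb v t
    have hM0 : 0 ≤ M := by
      simpa using (norm_nonneg _).trans (hM 0 t ⟨ha0.trans hat, le_rfl⟩)
    have hbound : ∀ n, ‖d v t‖ ≤ M * (1 / 2 : ℝ) ^ n := by
      intro n
      have h1 := norm_le_of_hasDerivAt_iterate K d hd (b := t) ha n v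
        (fun s hs => hM n s ⟨ha0.trans hs.1, hs.2⟩) t ⟨hat, le_rfl⟩
      have hn : (0 : ℝ) < n ! := by positivity
      have h2 : ρ * (t - a) ≤ 1 / 2 := by
        calc ρ * (t - a) ≤ ρ * (2 * ρ)⁻¹ := by gcongr; linarith
          _ = 1 / 2 := by field_simp
      calc ‖d v t‖ ≤ M * ρ ^ n * n ! * ((t - a) ^ n / n !) := h1
        _ = M * (ρ * (t - a)) ^ n := by rw [mul_pow]; field_simp
        _ ≤ M * (1 / 2 : ℝ) ^ n := by
          have : 0 ≤ ρ * (t - a) := mul_nonneg hρ.le (sub_nonneg.2 hat)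
          gcongr
    have hlim : Tendsto (fun n : ℕ => M * (1 / 2 : ℝ) ^ n) atTop (𝓝 0) := by
      simpa using (tendsto_pow_atTop_nhds_zero_of_lt_one (by norm_num : (0 : ℝ) ≤ 1 / 2)
        (by norm_num)).const_mul M
    exact norm_le_zero_iff.1 (ge_of_tendsto' hlim hbound)
  have key : ∀ n : ℕ, ∀ t, 0 ≤ t → t ≤ n * (2 * ρ)⁻¹ → ∀ v, d v t = 0 := by
    intro n
    have hρ' : 0 < (2 * ρ)⁻¹ := by positivity
    induction n with
    | zero => intro t ht ht' v; rw [le_antisymm (by simpa using ht') ht]; exact h0 v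
    | succ n ih =>
      intro t ht ht' v
      rcases le_total t (n * (2 * ρ)⁻¹) with h | h
      · exact ih t ht h v
      · exact step _ (by positivity) (ih _ (by positivity) le_rfl) t h
          (by push_cast at ht'; linarith) v
  intro v t ht
  obtain ⟨n, hn⟩ := exists_nat_ge (t / (2 * ρ)⁻¹)
  exact key n t ht ((div_le_iff₀ (by positivity)).1 hn) v

end Uniqueness

/-! ### Unitary groups generated by skew-symmetric operators with analytic vectors -/

section Group

open scoped Nat

variable {H : Type*} [NormedAddCommGroup H] [InnerProductSpace ℂ H]

theorem denseRange_incl [CompleteSpace H] (ket : HilbertBasis ℕ ℂ H) : DenseRange (incl ket) := by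
  have h := ket.dense_span
  rw [← Finsupp.range_linearCombination, ← Submodule.dense_iff_topologicalClosure_eq_top] at h
  exact h

/-- Every finite combination of Fock states is an analytic vector of `K`, with a radius of
convergence of at least `1 / ρ`. -/
def HasAnalyticVectors (ket : HilbertBasis ℕ ℂ H) (K : Module.End ℂ FiniteVec) (ρ : ℝ) : Prop :=
  ∀ v, ∃ M, ∀ n, ‖incl ket ((K ^ n) v)‖ ≤ M * ρ ^ n * n !

/-- `K` is skew-symmetric on the finite combinations of Fock states. -/
def IsSkew (ket : HilbertBasis ℕ ℂ H) (K : Module.End ℂ FiniteVec) : Prop :=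
  ∀ v w, ⟪incl ket v, incl ket (K w)⟫_ℂ = -⟪incl ket (K v), incl ket w⟫_ℂ

/-- The power series of `exp (t K) v`. -/
def expSeries (ket : HilbertBasis ℕ ℂ H) (K : Module.End ℂ FiniteVec) (t : ℝ) (v : FiniteVec) : H :=
  ∑' n, (t ^ n / n ! : ℝ) • incl ket ((K ^ n) v)

variable {ket : HilbertBasis ℕ ℂ H} {K : Module.End ℂ FiniteVec} {ρ : ℝ}

theorem IsSkew.inner_pow (hK : IsSkew ket K) (n : ℕ) (v w : FiniteVec) :
    ⟪incl ket ((K ^ n) v), incl ket w⟫_ℂ = (-1) ^ n * ⟪incl ket v, incl ket ((K ^ n) w)⟫_ℂ := by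
  induction n generalizing w with
  | zero => simp
  | succ n ih =>
    have h := hK ((K ^ n) v) w
    rw [pow_succ', Module.End.mul_apply, ← neg_eq_iff_eq_neg.2 h, ih, ← Module.End.mul_apply,
      ← pow_succ, ← pow_succ']
    ring

theorem HasAnalyticVectors.neg (han : HasAnalyticVectors ket K ρ) :
    HasAnalyticVectors ket (-K) ρ := by
  have h : ∀ n v, ‖incl ket (((-K) ^ n) v)‖ = ‖incl ket ((K ^ n) v)‖ := by
    intro n
    induction n with
    | zero => intro v; rfl
    | succ n ih =>
      intro v
      rw [pow_succ, pow_succ, Module.End.mul_apply, Module.End.mul_apply, LinearMap.neg_apply,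
        map_neg, map_neg, norm_neg, ih]
  intro v
  obtain ⟨M, hM⟩ := han v
  exact ⟨M, fun n => (h n v).trans_le (hM n)⟩

variable [CompleteSpace H]

theorem HasAnalyticVectors.summable (han : HasAnalyticVectors ket K ρ) (hρ : 0 ≤ ρ) {t : ℝ}
    (ht : ρ * |t| < 1) (v : FiniteVec) :
    Summable fun n => (t ^ n / n ! : ℝ) • incl ket ((K ^ n) v) := by
  obtain ⟨M, hM⟩ := han v
  exact summable_exp_term hρ hM ht

theorem HasAnalyticVectors.inner_expSeries (han : HasAnalyticVectors ket K ρ) (hK : IsSkew ket K)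
    (hρ : 0 ≤ ρ) {t : ℝ} (ht : 2 * ρ * |t| < 1) (v w : FiniteVec) :
    ⟪expSeries ket K t v, expSeries ket K t w⟫_ℂ = ⟪incl ket v, incl ket w⟫_ℂ := by
  have ht' : ρ * |t| < 1 := by nlinarith [mul_nonneg hρ (abs_nonneg t)]
  obtain ⟨M, hM⟩ := han w
  have hk : ∀ n, ‖⟪incl ket v, incl ket ((K ^ n) w)⟫_ℂ‖ ≤ (‖incl ket v‖ * M) * ρ ^ n * n ! := by
    intro n
    calc _ ≤ ‖incl ket v‖ * ‖incl ket ((K ^ n) w)‖ := norm_inner_le_norm _ _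
      _ ≤ ‖incl ket v‖ * (M * ρ ^ n * n !) := by gcongr; exact hM n
      _ = _ := by ring
  obtain ⟨h1, h2⟩ := exp_double_series (s := -t) (t := t) hρ hk (by rw [abs_neg]; linarith)
  have hv := (han.summable hρ ht' v).hasSum
  have hw := (han.summable hρ ht' w).hasSum
  have hterm : ∀ i j : ℕ, ⟪(t ^ i / i ! : ℝ) • incl ket ((K ^ i) v),
      (t ^ j / j ! : ℝ) • incl ket ((K ^ j) w)⟫_ℂ =
        ((-t) ^ i / i ! * (t ^ j / j !) : ℝ) • ⟪incl ket v, incl ket ((K ^ (i + j)) w)⟫_ℂ := by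
    intro i j
    rw [← Complex.coe_smul, ← Complex.coe_smul, inner_smul_left, inner_smul_right, hK.inner_pow,
      ← Module.End.mul_apply, ← pow_add, Complex.conj_ofReal, Complex.real_smul, neg_pow]
    push_cast
    ring
  have hin : ∀ y : H, ⟪expSeries ket K t v, y⟫_ℂ =
      ∑' i, ⟪(t ^ i / i ! : ℝ) • incl ket ((K ^ i) v), y⟫_ℂ := by
    intro y
    have := (hv.mapL (innerSL ℂ y)).star
    simpa [expSeries] using this.tsum_eq.symm
  have hin2 : ∀ y : H, ⟪y, expSeries ket K t w⟫_ℂ =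
      ∑' i, ⟪y, (t ^ i / i ! : ℝ) • incl ket ((K ^ i) w)⟫_ℂ := by
    intro y
    have := hw.mapL (innerSL ℂ y)
    simpa [expSeries] using this.tsum_eq.symm
  rw [hin]
  simp_rw [hin2, hterm]
  rw [← h1.tsum_prod, h2, neg_add_cancel, tsum_eq_single 0 (by intro n hn; simp [hn])]
  simp

theorem HasAnalyticVectors.exists_isometry (han : HasAnalyticVectors ket K ρ) (hK : IsSkew ket K)
    (hρ : 0 ≤ ρ) {t : ℝ} (ht : 2 * ρ * |t| < 1) :
    ∃ T : H →L[ℂ] H, (∀ x, ‖T x‖ = ‖x‖) ∧ ∀ v, T (incl ket v) = expSeries ket K t v := by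
  have ht' : ρ * |t| < 1 := by nlinarith [mul_nonneg hρ (abs_nonneg t)]
  let f : FiniteVec →ₗ[ℂ] H :=
    { toFun := expSeries ket K t
      map_add' := fun v w => by
        simp only [expSeries, map_add, smul_add]
        exact (han.summable hρ ht' v).tsum_add (han.summable hρ ht' w)
      map_smul' := fun c v => by
        simp only [expSeries, map_smul, RingHom.id_apply]
        rw [← (han.summable hρ ht' v).tsum_const_smul c]
        exact tsum_congr fun n => smul_comm _ _ _ }
  have hnorm : ∀ v, ‖f v‖ = ‖incl ket v‖ := fun v => by
    have h := han.inner_expSeries hK hρ ht v v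
    rw [inner_self_eq_norm_sq_to_K, inner_self_eq_norm_sq_to_K] at h
    have h' : ‖expSeries ket K t v‖ ^ 2 = ‖incl ket v‖ ^ 2 := by exact_mod_cast h
    exact (pow_left_inj₀ (norm_nonneg _) (norm_nonneg _) two_ne_zero).1 h'
  have hext := LinearMap.extendOfNorm_eq (f := f) (denseRange_incl ket)
    ⟨1, fun v => by rw [one_mul, hnorm]⟩
  refine ⟨f.extendOfNorm (incl ket), fun x => ?_, hext⟩
  refine (denseRange_incl ket).induction_on (p := fun x => ‖f.extendOfNorm (incl ket) x‖ = ‖x‖) x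
    (isClosed_eq (by fun_prop) (by fun_prop)) fun v => ?_
  rw [hext, hnorm]

theorem HasAnalyticVectors.hasDerivAt_expSeries (han : HasAnalyticVectors ket K ρ) (hρ : 0 < ρ)
    (v : FiniteVec) :
    HasDerivAt (fun t => expSeries ket K t v) (incl ket (K v)) 0 := by
  obtain ⟨M, hM⟩ := han v
  rw [hasDerivAt_iff_isLittleO_nhds_zero]
  refine Asymptotics.IsBigO.trans_isLittleO (g := fun t : ℝ => t ^ 2) ?_
    (by simpa using Asymptotics.isLittleO_pow_id (𝕜 := ℝ) one_lt_two)
  refine Asymptotics.IsBigO.of_bound (M * ρ ^ 2 * 2) ?_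
  have hev : ∀ᶠ t : ℝ in 𝓝 0, ρ * |t| < 1 / 2 := by
    have : Tendsto (fun t : ℝ => ρ * |t|) (𝓝 0) (𝓝 (ρ * |0|)) :=
      (by fun_prop : Continuous fun t : ℝ => ρ * |t|).tendsto 0
    exact this.eventually_lt_const (by simp)
  filter_upwards [hev] with t ht
  have hs := summable_exp_term hρ.le hM (t := t) (by linarith)
  have h0 : expSeries ket K 0 v = incl ket v := by
    rw [expSeries, tsum_eq_single 0 (by intro n hn; simp [hn])]
    simp
  have htail : expSeries ket K (0 + t) v - expSeries ket K 0 v - t • incl ket (K v) =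
      ∑' n, (t ^ (n + 2) / (n + 2)! : ℝ) • incl ket ((K ^ (n + 2)) v) := by
    rw [h0, zero_add, expSeries, ← hs.sum_add_tsum_nat_add 2]
    simp only [Finset.sum_range_succ, Finset.sum_range_zero, pow_zero, pow_one, Nat.factorial,
      Module.End.one_apply, Nat.cast_one, div_one, one_smul, zero_add, mul_one]
    abel
  rw [htail]
  have hM0 : 0 ≤ M := by simpa using (norm_nonneg _).trans (hM 0)
  have hg := (hasSum_geometric_of_lt_one (r := ρ * |t|) (by positivity) (by linarith)).mul_left
    (M * (ρ * |t|) ^ 2)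
  refine (tsum_of_norm_bounded hg fun n => (norm_exp_term_le hM t (n + 2)).trans_eq (by ring)).trans
    ?_
  have : (1 - ρ * |t|)⁻¹ ≤ 2 := by
    rw [inv_le_comm₀ (by linarith) two_pos]; linarith
  calc M * (ρ * |t|) ^ 2 * (1 - ρ * |t|)⁻¹ ≤ M * (ρ * |t|) ^ 2 * 2 := by gcongr
    _ = M * ρ ^ 2 * 2 * ‖t ^ 2‖ := by rw [norm_pow, Real.norm_eq_abs]; ring

theorem eq_of_eq_on_incl {S T : H →L[ℂ] H} (ket : HilbertBasis ℕ ℂ H)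
    (h : ∀ v, S (incl ket v) = T (incl ket v)) : S = T :=
  ContinuousLinearMap.ext fun x => congrFun
    ((denseRange_incl ket).equalizer S.continuous T.continuous (funext h)) x

/-- A local one-parameter semigroup of operators, defined for times `t` with `c |t| < 1`, extends
to a one-parameter group through `U t = W (t / N) ^ N`. -/
theorem exists_group_of_local_group {A : Type*} [Monoid A] {W : ℝ → A} {c : ℝ} (hc : 0 < c)
    (hadd : ∀ s t : ℝ, c * |s| < 1 → c * |t| < 1 → W s * W t = W (s + t)) (h0 : W 0 = 1) :
    ∃ U : ℝ → A, (∀ s t, U (s + t) = U s * U t) ∧ (∀ t : ℝ, c * |t| < 1 → U t = W t) ∧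
      ∀ t : ℝ, ∃ N : ℕ, c * |t / N| < 1 ∧ U t = W (t / N) ^ N := by
  have hpow : ∀ (n : ℕ) (t : ℝ), c * |n * t| < 1 → W t ^ n = W (n * t) := by
    intro n
    induction n with
    | zero => intro t _; simp [h0]
    | succ n ih =>
      intro t ht
      push_cast at ht ⊢
      rw [abs_mul, abs_of_nonneg (by positivity)] at ht
      have hn : c * |n * t| < 1 := by
        rw [abs_mul, Nat.abs_cast]
        nlinarith [mul_nonneg hc.le (abs_nonneg t)]
      have h1 : c * |t| < 1 := by
        have := mul_nonneg (Nat.cast_nonneg (α := ℝ) n) (mul_nonneg hc.le (abs_nonneg t))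
        nlinarith
      rw [pow_succ, ih t hn, hadd _ _ hn h1]
      congr 1
      ring
  have hsmall : ∀ {t : ℝ} {N : ℕ}, c * |t| < N → c * |t / N| < 1 := by
    intro t N h
    have hN : (0 : ℝ) < N := lt_of_le_of_lt (by positivity) h
    rw [abs_div, Nat.abs_cast, ← mul_div_assoc, div_lt_one hN]
    exact h
  have hpos : ∀ {t : ℝ} {N : ℕ}, c * |t| < N → (N : ℝ) ≠ 0 := by
    intro t N h
    exact (lt_of_le_of_lt (by positivity) h).ne'
  -- the value of `W (t / N) ^ N` does not depend on the number of steps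
  have hrefine : ∀ {t : ℝ} {N M : ℕ}, c * |t| < N → M ≠ 0 →
      W (t / N) ^ N = W (t / (N * M : ℕ)) ^ (N * M) := by
    intro t N M hN hM
    have hM' : (M : ℝ) ≠ 0 := Nat.cast_ne_zero.2 hM
    have hN' := hpos hN
    have heq : (M : ℝ) * (t / (N * M : ℕ)) = t / N := by push_cast; field_simp
    have := hpow M (t / (N * M : ℕ)) (by rw [heq]; exact hsmall hN)
    rw [heq] at this
    rw [← this, ← pow_mul, mul_comm M N]
  have hindep : ∀ {t : ℝ} {N M : ℕ}, c * |t| < N → c * |t| < M →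
      W (t / N) ^ N = W (t / M) ^ M := by
    intro t N M hN hM
    rw [hrefine hN (M := M) (by exact_mod_cast hpos hM),
      hrefine hM (M := N) (by exact_mod_cast hpos hN), mul_comm N M]
  let n (t : ℝ) : ℕ := ⌊c * |t|⌋₊ + 1
  have hn : ∀ t, c * |t| < n t := fun t => by
    simpa [n] using Nat.lt_floor_add_one (c * |t|)
  refine ⟨fun t => W (t / n t) ^ n t, fun s t => ?_, fun t ht => ?_, fun t =>
    ⟨n t, hsmall (hn t), rfl⟩⟩
  · let N := n s + n t + n (s + t)
    have e1 : c * |s| < N := (hn s).trans_le (by simp only [N]; norm_cast; omega)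
    have e2 : c * |t| < N := (hn t).trans_le (by simp only [N]; norm_cast; omega)
    have e3 : c * |s + t| < N := (hn _).trans_le (by simp only [N]; norm_cast; omega)
    have hcomm : Commute (W (s / N)) (W (t / N)) := by
      rw [Commute, SemiconjBy, hadd _ _ (hsmall e1) (hsmall e2),
        hadd _ _ (hsmall e2) (hsmall e1), add_comm]
    change W ((s + t) / n (s + t)) ^ n (s + t) = W (s / n s) ^ n s * W (t / n t) ^ n t
    rw [hindep (hn (s + t)) e3, hindep (hn s) e1, hindep (hn t) e2, ← hcomm.mul_pow,
      hadd _ _ (hsmall e1) (hsmall e2), add_div]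
  · have := hindep (hn t) (M := 1) (by simpa using ht)
    simpa using this

/-- Existence half of Nelson's theorem for the operators at hand: the exponential series defines
isometries for small times, which are then composed. -/
theorem HasAnalyticVectors.exists_unitaryGroup (han : HasAnalyticVectors ket K ρ)
    (hK : IsSkew ket K) (hρ : 0 < ρ) : ∃ U, IsUnitaryGroupOf ket K U := by
  have hex : ∀ t, ∃ T : H →L[ℂ] H, 2 * ρ * |t| < 1 →
      (∀ x, ‖T x‖ = ‖x‖) ∧ ∀ v, T (incl ket v) = expSeries ket K t v := by
    intro t
    by_cases ht : 2 * ρ * |t| < 1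
    · obtain ⟨T, hT⟩ := han.exists_isometry hK hρ.le ht
      exact ⟨T, fun _ => hT⟩
    · exact ⟨0, fun h => absurd h ht⟩
  choose W hW using hex
  have hW0 : W 0 = 1 := by
    refine eq_of_eq_on_incl ket fun v => ?_
    rw [(hW 0 (by simp)).2, expSeries, tsum_eq_single 0 (by intro n hn; simp [hn])]
    simp
  have hmul : ∀ s t, 2 * ρ * |s| < 1 → 2 * ρ * |t| < 1 → 2 * ρ * |s + t| < 1 →
      W s * W t = W (s + t) := by
    intro s t hs ht hst
    refine eq_of_eq_on_incl ket fun v => ?_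
    obtain ⟨M, hM⟩ := han v
    obtain ⟨h1, h2⟩ := exp_double_series (s := t) (t := s) hρ.le hM (by linarith)
    have hsum := ((han.summable hρ.le (t := t) (by linarith [mul_nonneg hρ.le (abs_nonneg t)])
      v).hasSum.mapL (W s)).tsum_eq
    rw [mul_apply_eq_comp, (hW t ht).2, (hW _ hst).2, expSeries, ← hsum, expSeries,
      add_comm s t, ← h2, h1.tsum_prod]
    refine tsum_congr fun j => ?_
    rw [ContinuousLinearMap.map_smul_of_tower, (hW s hs).2, expSeries,
      ← ((han.summable hρ.le (by linarith [mul_nonneg hρ.le (abs_nonneg s)]) _).tsum_const_smul _)]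
    refine tsum_congr fun i => ?_
    rw [smul_smul, ← Module.End.mul_apply, ← pow_add, add_comm i j]
  have hmul' : ∀ s t, 4 * ρ * |s| < 1 → 4 * ρ * |t| < 1 → W s * W t = W (s + t) := by
    intro s t hs ht
    refine hmul s t (by linarith [mul_nonneg hρ.le (abs_nonneg s)])
      (by linarith [mul_nonneg hρ.le (abs_nonneg t)]) ?_
    nlinarith [mul_le_mul_of_nonneg_left (abs_add_le s t) hρ.le]
  obtain ⟨U, hadd, hUW, hUpow⟩ := exists_group_of_local_group (by positivity) hmul' hW0
  have hsmall : ∀ {t : ℝ}, 4 * ρ * |t| < 1 → 2 * ρ * |t| < 1 := fun {t} h => by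
    linarith [mul_nonneg hρ.le (abs_nonneg t)]
  have hU0 : U 0 = 1 := by rw [hUW 0 (by simp), hW0]
  have hUnorm : ∀ t x, ‖U t x‖ = ‖x‖ := by
    intro t x
    obtain ⟨N, hN, hU⟩ := hUpow t
    rw [hU]
    have h1 := (hW _ (hsmall hN)).1
    clear hU hN
    generalize W (t / N) = T at h1
    induction N with
    | zero => simp
    | succ n ih => rw [pow_succ', mul_apply_eq_comp, h1, ih]
  have hderiv : ∀ v, HasDerivAt (fun t => U t (incl ket v)) (incl ket (K v)) 0 := by
    intro v
    refine (han.hasDerivAt_expSeries hρ v).congr_of_eventuallyEq ?_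
    have : Tendsto (fun t : ℝ => 4 * ρ * |t|) (𝓝 0) (𝓝 (4 * ρ * |0|)) :=
      (by fun_prop : Continuous fun t : ℝ => 4 * ρ * |t|).tendsto 0
    filter_upwards [this.eventually_lt_const (u := 1) (by simp)] with t ht
    rw [hUW t ht, (hW t (hsmall ht)).2]
  refine ⟨U, ⟨fun t => ?_, hU0, hadd, fun ψ => ?_, hderiv⟩⟩
  · have hinv : U t * U (-t) = 1 := by rw [← hadd, add_neg_cancel, hU0]
    have hstar : star (U t) * U t = 1 := by
      have := (ContinuousLinearMap.norm_map_iff_adjoint_comp_self (U t)).1 (hUnorm t)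
      exact this
    refine ⟨hstar, ?_⟩
    have h2 : star (U t) = U (-t) := by
      calc star (U t) = star (U t) * (U t * U (-t)) := by rw [hinv, mul_one]
        _ = U (-t) := by rw [← mul_assoc, hstar, one_mul]
    rw [h2, hinv]
  · -- strong continuity at `0`, first on a dense set
    have hzero : ContinuousAt (fun t => U t ψ) 0 := by
      rw [Metric.continuousAt_iff]
      intro ε hε
      obtain ⟨v, hv⟩ := (denseRange_incl ket).exists_dist_lt ψ (show 0 < ε / 3 by positivity)
      obtain ⟨δ, hδ, h⟩ := Metric.continuousAt_iff.1 (hderiv v).continuousAt (ε / 3) (by positivity)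
      refine ⟨δ, hδ, fun t ht => ?_⟩
      have h1 : dist (U t ψ) (U t (incl ket v)) = dist ψ (incl ket v) := by
        rw [dist_eq_norm, ← map_sub, hUnorm, dist_eq_norm]
      have h2 := h ht
      simp only [hU0, one_apply_eq_self] at h2 ⊢
      calc dist (U t ψ) ψ ≤ dist (U t ψ) (U t (incl ket v)) + dist (U t (incl ket v)) (incl ket v)
            + dist (incl ket v) ψ := dist_triangle4 _ _ _ _
        _ < ε / 3 + ε / 3 + ε / 3 := by
          rw [h1, dist_comm (incl ket v) ψ]; linarith
        _ = ε := by ring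
    rw [continuous_iff_continuousAt]
    intro t
    have h1 : (fun s => U s ψ) = fun s => U t (U (s - t) ψ) := by
      funext s
      rw [← mul_apply_eq_comp, ← hadd, add_sub_cancel]
    rw [h1]
    refine (U t).continuous.continuousAt.comp ?_
    have h2 : ContinuousAt (fun s : ℝ => s - t) t := by fun_prop
    refine ContinuousAt.comp (g := fun t => U t ψ) ?_ h2
    rwa [sub_self]

theorem IsUnitaryGroupOf.norm_map {U : ℝ → H →L[ℂ] H} (hU : IsUnitaryGroupOf ket K U) (t : ℝ)
    (x : H) : ‖U t x‖ = ‖x‖ :=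
  (ContinuousLinearMap.norm_map_iff_adjoint_comp_self (U t)).2 (hU.unitary t).1 x

theorem IsUnitaryGroupOf.hasDerivAt_apply {U : ℝ → H →L[ℂ] H} (hU : IsUnitaryGroupOf ket K U)
    (v : FiniteVec) (t : ℝ) :
    HasDerivAt (fun t => U t (incl ket v)) (U t (incl ket (K v))) t := by
  have h1 : (fun s => U s (incl ket v)) = fun s => U t (U (s - t) (incl ket v)) := by
    funext s
    rw [← mul_apply_eq_comp, ← hU.map_add, add_sub_cancel]
  rw [h1]
  have h2 : HasDerivAt (fun s => U (s - t) (incl ket v)) (incl ket (K v)) t := by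
    have h := hU.hasDerivAt v
    rw [← sub_self t] at h
    exact h.comp_sub_const t t
  exact ((U t).restrictScalars ℝ).hasFDerivAt.comp_hasDerivAt t h2

/-- The reversed group is generated by `-K`. -/
theorem IsUnitaryGroupOf.neg {U : ℝ → H →L[ℂ] H} (hU : IsUnitaryGroupOf ket K U) :
    IsUnitaryGroupOf ket (-K) fun t => U (-t) where
  unitary t := hU.unitary _
  map_zero := by rw [neg_zero, hU.map_zero]
  map_add s t := by rw [neg_add, hU.map_add]
  continuous ψ := (hU.continuous ψ).comp continuous_neg
  hasDerivAt v := by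
    have h := hU.hasDerivAt v
    rw [← neg_zero] at h
    simpa [Function.comp_def] using h.scomp (0 : ℝ) (hasDerivAt_neg (0 : ℝ))

theorem IsUnitaryGroupOf.eq_of_nonneg {U U' : ℝ → H →L[ℂ] H} (han : HasAnalyticVectors ket K ρ)
    (hρ : 0 < ρ) (hU : IsUnitaryGroupOf ket K U) (hU' : IsUnitaryGroupOf ket K U') {t : ℝ}
    (ht : 0 ≤ t) : U t = U' t := by
  refine eq_of_eq_on_incl ket fun v => sub_eq_zero.1 ?_
  refine eq_zero_of_hasDerivAt_iterate K (fun v t => U t (incl ket v) - U' t (incl ket v))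
    (fun v t => (hU.hasDerivAt_apply v t).sub (hU'.hasDerivAt_apply v t))
    (fun v => by simp [hU.map_zero, hU'.map_zero]) hρ (fun v T => ?_) v t ht
  obtain ⟨M, hM⟩ := han v
  refine ⟨2 * M, fun n t _ => (norm_sub_le _ _).trans ?_⟩
  rw [hU.norm_map, hU'.norm_map]
  linarith [hM n]

/-- Nelson's theorem for the operators at hand: a skew-symmetric operator all of whose finite
vectors are analytic generates a unique unitary group. -/
theorem HasAnalyticVectors.existsUnique (han : HasAnalyticVectors ket K ρ)
    (hK : IsSkew ket K) (hρ : 0 < ρ) : ∃! U, IsUnitaryGroupOf ket K U := by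
  obtain ⟨U, hU⟩ := han.exists_unitaryGroup hK hρ
  refine ⟨U, hU, fun U' hU' => funext fun t => ?_⟩
  rcases le_total 0 t with ht | ht
  · exact hU'.eq_of_nonneg han hρ hU ht
  · simpa using hU'.neg.eq_of_nonneg han.neg hρ hU.neg (neg_nonneg.2 ht)

end Group

/-! ### The ladder operators on finite combinations of Fock states -/

section Ladder

open scoped Nat

theorem ann_single (n : ℕ) (c : ℂ) :
    ann (Finsupp.single n c) = Finsupp.single (n - 1) (c * (√n : ℝ)) := by
  simp [ann, Finsupp.linearCombination_single]

theorem cre_single (n : ℕ) (c : ℂ) :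
    cre (Finsupp.single n c) = Finsupp.single (n + 1) (c * (√((n : ℝ) + 1) : ℝ)) := by
  simp [cre, Finsupp.linearCombination_single]

theorem ofReal_sqrt_mul_self {x : ℝ} (hx : 0 ≤ x) : ((√x : ℝ) : ℂ) * (√x : ℝ) = x := by
  rw [← Complex.ofReal_mul, Real.mul_self_sqrt hx]

theorem ann_mul_cre : ann * cre = cre * ann + 1 := by
  refine Finsupp.lhom_ext fun n c => ?_
  simp only [Module.End.mul_apply, LinearMap.add_apply, Module.End.one_apply, cre_single,
    ann_single]
  rcases n with _ | n
  · simp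
  · have h1 := ofReal_sqrt_mul_self (x := (n : ℝ) + 1) (by positivity)
    have h2 := ofReal_sqrt_mul_self (x := (n : ℝ) + 1 + 1) (by positivity)
    simp only [Nat.add_sub_cancel]
    push_cast at h1 h2 ⊢
    rw [← Finsupp.single_add, mul_assoc, h2, mul_assoc, h1]
    congr 1
    ring

variable {H : Type*} [NormedAddCommGroup H] [InnerProductSpace ℂ H] (ket : HilbertBasis ℕ ℂ H)

theorem incl_single (n : ℕ) (c : ℂ) : incl ket (Finsupp.single n c) = c • ket n := by
  simp [incl]

theorem inner_incl_ann (v w : FiniteVec) :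
    ⟪incl ket v, incl ket (ann w)⟫_ℂ = ⟪incl ket (cre v), incl ket w⟫_ℂ := by
  induction v using Finsupp.induction_linear with
  | zero => simp
  | add v v' h h' => simp only [map_add, inner_add_left, h, h']
  | single m c =>
    induction w using Finsupp.induction_linear with
    | zero => simp
    | add w w' h h' => simp only [map_add, inner_add_right, h, h']
    | single n d =>
      rw [ann_single, cre_single, incl_single, incl_single, incl_single, incl_single]
      simp only [inner_smul_left, inner_smul_right, orthonormal_iff_ite.1 ket.orthonormal]
      rcases n with _ | n
      · simp
      · by_cases h : m = n
        · subst h; simp; ring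
        · simp [h]

theorem inner_incl_cre (v w : FiniteVec) :
    ⟪incl ket v, incl ket (cre w)⟫_ℂ = ⟪incl ket (ann v), incl ket w⟫_ℂ := by
  rw [← inner_conj_symm, ← inner_incl_ann, inner_conj_symm]

/-- The squeezing generator `(r/2) (e^{-2iθ} a² - e^{2iθ} (a†)²)`. -/
def squeezeGen (r θ : ℝ) : Module.End ℂ FiniteVec :=
  ((r / 2 : ℝ) : ℂ) • (Complex.exp (-(2 * θ * Complex.I)) • ann ^ 2
    - Complex.exp (2 * θ * Complex.I) • cre ^ 2)

theorem conj_exp_two_mul_I (θ : ℝ) :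
    (starRingEnd ℂ) (Complex.exp (2 * θ * Complex.I)) = Complex.exp (-(2 * θ * Complex.I)) := by
  rw [← Complex.exp_conj]
  simp [Complex.conj_ofNat]

theorem norm_exp_two_mul_I (θ : ℝ) : ‖Complex.exp (2 * θ * Complex.I)‖ = 1 := by
  have := Complex.norm_exp_ofReal_mul_I (2 * θ)
  push_cast at this
  exact this

theorem squeezeGen_neg (r θ : ℝ) : squeezeGen (-r) θ = -squeezeGen r θ := by
  refine LinearMap.ext fun v => ?_
  simp only [squeezeGen, neg_div, Complex.ofReal_neg, LinearMap.smul_apply, LinearMap.neg_apply,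
    neg_smul]

theorem isSkew_squeezeGen (r θ : ℝ) : IsSkew ket (squeezeGen r θ) := by
  intro v w
  simp only [squeezeGen, pow_two, LinearMap.smul_apply, LinearMap.sub_apply, Module.End.mul_apply,
    map_smul, map_sub, inner_smul_left, inner_smul_right, inner_sub_left, inner_sub_right,
    inner_incl_ann, inner_incl_cre, ← conj_exp_two_mul_I, Complex.conj_conj, Complex.conj_ofReal]
  ring

theorem ann_cre (v : FiniteVec) : ann (cre v) = cre (ann v) + v :=
  LinearMap.congr_fun ann_mul_cre v

theorem ann_mul_squeezeGen (r θ : ℝ) : ann * squeezeGen r θ =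
    squeezeGen r θ * ann - ((r : ℂ) * Complex.exp (2 * θ * Complex.I)) • cre := by
  refine LinearMap.ext fun v => ?_
  simp only [squeezeGen, pow_two, LinearMap.smul_apply, LinearMap.sub_apply, Module.End.mul_apply,
    map_smul, map_sub, map_add, ann_cre]
  push_cast
  module

theorem cre_mul_squeezeGen (r θ : ℝ) : cre * squeezeGen r θ =
    squeezeGen r θ * cre - ((r : ℂ) * Complex.exp (-(2 * θ * Complex.I))) • ann := by
  refine LinearMap.ext fun v => ?_
  simp only [squeezeGen, pow_two, LinearMap.smul_apply, LinearMap.sub_apply, Module.End.mul_apply,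
    map_smul, map_sub, map_add, ann_cre]
  push_cast
  module

/-! ### Finite combinations of Fock states are analytic vectors of the squeezing generator -/

/-- The weighted `ℓ¹` norm `∑ₖ |vₖ| u k`. -/
def weightedNorm (u : ℕ → ℝ) (v : FiniteVec) : ℝ := v.sum fun k c => ‖c‖ * u k

theorem weightedNorm_eq_sum (u : ℕ → ℝ) {v : FiniteVec} {s : Finset ℕ} (h : v.support ⊆ s) :
    weightedNorm u v = ∑ k ∈ s, ‖v k‖ * u k :=
  Finsupp.sum_of_support_subset _ h _ fun _ _ => by simp

theorem weightedNorm_single (u : ℕ → ℝ) (k : ℕ) (c : ℂ) :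
    weightedNorm u (Finsupp.single k c) = ‖c‖ * u k := by
  simp [weightedNorm]

theorem weightedNorm_add_le {u : ℕ → ℝ} (hu : ∀ k, 0 ≤ u k) (v w : FiniteVec) :
    weightedNorm u (v + w) ≤ weightedNorm u v + weightedNorm u w := by
  rw [weightedNorm_eq_sum u Finsupp.support_add,
    weightedNorm_eq_sum u (Finset.subset_union_left (s₂ := w.support)),
    weightedNorm_eq_sum u (Finset.subset_union_right (s₁ := v.support)), ← Finset.sum_add_distrib]
  refine Finset.sum_le_sum fun k _ => ?_
  rw [← add_mul, Finsupp.add_apply]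
  exact mul_le_mul_of_nonneg_right (norm_add_le _ _) (hu k)

theorem weightedNorm_map_le {u u' : ℕ → ℝ} (hu : ∀ k, 0 ≤ u k) {C : ℝ}
    (L : Module.End ℂ FiniteVec)
    (h : ∀ k c, weightedNorm u (L (Finsupp.single k c)) ≤ C * (‖c‖ * u' k)) (v : FiniteVec) :
    weightedNorm u (L v) ≤ C * weightedNorm u' v := by
  have h1 : L v = ∑ k ∈ v.support, L (Finsupp.single k (v k)) := by
    conv_lhs => rw [← Finsupp.sum_single v]
    rw [Finsupp.sum, map_sum]
  rw [h1, weightedNorm_eq_sum u' subset_rfl, Finset.mul_sum]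
  exact (Finset.le_sum_of_subadditive (weightedNorm u) (by simp [weightedNorm])
    (weightedNorm_add_le hu) _ _).trans (Finset.sum_le_sum fun k _ => h k _)

/-- The weights `(k + 2) (k + 4) ⋯ (k + 2n)`; an operator quadratic in `a, a†` is bounded from
the norm with weight `n + 1` to the norm with weight `n`. -/
def fockWeight (n k : ℕ) : ℝ := ∏ j ∈ Finset.range n, ((k : ℝ) + 2 + 2 * j)

theorem fockWeight_nonneg (n k : ℕ) : 0 ≤ fockWeight n k :=
  Finset.prod_nonneg fun _ _ => by positivity

theorem fockWeight_mono (n : ℕ) : Monotone (fockWeight n) := by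
  intro k l h
  have : (k : ℝ) ≤ l := by exact_mod_cast h
  exact Finset.prod_le_prod (fun _ _ => by positivity) fun _ _ => by linarith

theorem fockWeight_succ (n k : ℕ) :
    fockWeight (n + 1) k = ((k : ℝ) + 2) * fockWeight n (k + 2) := by
  rw [fockWeight, Finset.prod_range_succ', fockWeight, mul_comm]
  push_cast
  congr 1
  · ring
  · exact Finset.prod_congr rfl fun _ _ => by ring

theorem fockWeight_le (n k : ℕ) : fockWeight n k ≤ 4 ^ n * n ! * 2 ^ k := by
  have h1 : fockWeight n k * k ! ≤ 2 ^ n * (k + n)! := by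
    induction n with
    | zero => simp [fockWeight]
    | succ n ih =>
      rw [fockWeight, Finset.prod_range_succ, ← fockWeight, ← add_assoc, Nat.factorial_succ]
      push_cast
      calc fockWeight n k * ((k : ℝ) + 2 + 2 * n) * k !
          = (fockWeight n k * k !) * (2 * (k / 2 + 1 + n)) := by ring
        _ ≤ (2 ^ n * (k + n)!) * (2 * (k + n + 1)) := by
          refine mul_le_mul ih ?_ (by positivity) (by positivity)
          have : (0 : ℝ) ≤ k := by positivity
          linarith
        _ = 2 ^ (n + 1) * (((k : ℝ) + n + 1) * (k + n)!) := by ring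
  have h2 : ((k + n)! : ℝ) ≤ 2 ^ (k + n) * (k ! * n !) := by
    have h := Nat.add_choose_mul_factorial_mul_factorial k n
    have h' := Nat.choose_le_two_pow (k + n) n
    rw [← h, mul_assoc]
    push_cast
    gcongr
    exact_mod_cast h'
  have hk : (0 : ℝ) < k ! := by positivity
  refine le_of_mul_le_mul_right ?_ hk
  calc fockWeight n k * k ! ≤ 2 ^ n * (k + n)! := h1
    _ ≤ 2 ^ n * (2 ^ (k + n) * (k ! * n !)) := by gcongr
    _ = 4 ^ n * n ! * 2 ^ k * k ! := by
      rw [pow_add, show (4 : ℝ) = 2 * 2 by norm_num, mul_pow]; ring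

theorem sqrt_natCast_add_one_le (k : ℕ) : √((k : ℝ) + 1) ≤ k + 2 := by
  rw [Real.sqrt_le_left (by positivity)]
  nlinarith [Nat.cast_nonneg (α := ℝ) k]

theorem weightedNorm_ann_le (n : ℕ) (v : FiniteVec) :
    weightedNorm (fockWeight n) (ann v) ≤ 1 * weightedNorm (fockWeight (n + 1)) v := by
  refine weightedNorm_map_le (fockWeight_nonneg n) ann (fun k c => ?_) v
  rw [ann_single, weightedNorm_single, norm_mul, Complex.norm_real, Real.norm_eq_abs,
    abs_of_nonneg (Real.sqrt_nonneg _), fockWeight_succ, one_mul, mul_assoc]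
  gcongr
  · exact fockWeight_nonneg _ _
  · exact (Real.sqrt_le_sqrt (by linarith)).trans (sqrt_natCast_add_one_le k)
  · exact fockWeight_mono n (by omega)

theorem weightedNorm_cre_le (n : ℕ) (v : FiniteVec) :
    weightedNorm (fockWeight n) (cre v) ≤ 1 * weightedNorm (fockWeight (n + 1)) v := by
  refine weightedNorm_map_le (fockWeight_nonneg n) cre (fun k c => ?_) v
  rw [cre_single, weightedNorm_single, norm_mul, Complex.norm_real, Real.norm_eq_abs,
    abs_of_nonneg (Real.sqrt_nonneg _), fockWeight_succ, one_mul, mul_assoc]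
  gcongr
  · exact fockWeight_nonneg _ _
  · exact sqrt_natCast_add_one_le k
  · exact fockWeight_mono n (by omega)

theorem weightedNorm_squeezeGen_le (r θ : ℝ) (n : ℕ) (v : FiniteVec) :
    weightedNorm (fockWeight n) (squeezeGen r θ v) ≤
      |r| * weightedNorm (fockWeight (n + 1)) v := by
  refine weightedNorm_map_le (fockWeight_nonneg n) _ (fun k c => ?_) v
  have hval : squeezeGen r θ (Finsupp.single k c) =
      Finsupp.single (k - 1 - 1) ((r / 2 : ℝ) * Complex.exp (-(2 * θ * Complex.I)) *
        (c * (√k : ℝ) * (√((k - 1 : ℕ) : ℝ) : ℝ))) +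
      Finsupp.single (k + 1 + 1) (-(r / 2 : ℝ) * Complex.exp (2 * θ * Complex.I) *
        (c * (√((k : ℝ) + 1) : ℝ) * (√(((k + 1 : ℕ) : ℝ) + 1) : ℝ))) := by
    simp only [squeezeGen, pow_two, LinearMap.smul_apply, LinearMap.sub_apply,
      Module.End.mul_apply, ann_single, cre_single, Finsupp.smul_single, smul_sub, smul_eq_mul]
    rw [sub_eq_add_neg, ← Finsupp.single_neg]
    congr 2 <;> ring
  rw [hval]
  refine (weightedNorm_add_le (fockWeight_nonneg n) _ _).trans ?_
  rw [weightedNorm_single, weightedNorm_single]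
  simp only [norm_mul, norm_neg, Complex.norm_real, norm_exp_two_mul_I, ← conj_exp_two_mul_I,
    RCLike.norm_conj, Real.norm_eq_abs, abs_of_nonneg (Real.sqrt_nonneg _), mul_one]
  have hk : (0 : ℝ) ≤ k := by positivity
  have h1 : √(k : ℝ) * √((k - 1 : ℕ) : ℝ) ≤ k + 2 := by
    have h : ((k - 1 : ℕ) : ℝ) ≤ k := by exact_mod_cast Nat.sub_le k 1
    calc √(k : ℝ) * √((k - 1 : ℕ) : ℝ) ≤ √(k : ℝ) * √(k : ℝ) := by gcongr
      _ = k := Real.mul_self_sqrt hk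
      _ ≤ k + 2 := by linarith
  have h2 : √((k : ℝ) + 1) * √(((k + 1 : ℕ) : ℝ) + 1) ≤ k + 2 := by
    push_cast
    calc √((k : ℝ) + 1) * √((k : ℝ) + 1 + 1) ≤ √((k : ℝ) + 2) * √((k : ℝ) + 2) := by
          gcongr ?_ * ?_ <;> exact Real.sqrt_le_sqrt (by linarith)
      _ = k + 2 := Real.mul_self_sqrt (by positivity)
  have h3 : fockWeight n (k - 1 - 1) ≤ fockWeight n (k + 2) := fockWeight_mono n (by omega)
  have h0 := fockWeight_nonneg n (k - 1 - 1)
  have h0' := fockWeight_nonneg n (k + 2)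
  rw [fockWeight_succ]
  calc |r / 2| * (‖c‖ * √(k : ℝ) * √((k - 1 : ℕ) : ℝ)) * fockWeight n (k - 1 - 1) +
        |r / 2| * (‖c‖ * √((k : ℝ) + 1) * √(((k + 1 : ℕ) : ℝ) + 1)) * fockWeight n (k + 1 + 1)
      = |r / 2| * ‖c‖ * ((√(k : ℝ) * √((k - 1 : ℕ) : ℝ)) * fockWeight n (k - 1 - 1)) +
        |r / 2| * ‖c‖ * ((√((k : ℝ) + 1) * √(((k + 1 : ℕ) : ℝ) + 1)) * fockWeight n (k + 2)) := by
        ring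
    _ ≤ |r / 2| * ‖c‖ * (((k : ℝ) + 2) * fockWeight n (k + 2)) +
        |r / 2| * ‖c‖ * (((k : ℝ) + 2) * fockWeight n (k + 2)) := by gcongr
    _ = |r| * (‖c‖ * (((k : ℝ) + 2) * fockWeight n (k + 2))) := by
        rw [abs_div, abs_two]; ring

theorem weightedNorm_squeezeGen_pow_le (r θ : ℝ) (m n : ℕ) (v : FiniteVec) :
    weightedNorm (fockWeight m) ((squeezeGen r θ ^ n) v) ≤
      |r| ^ n * weightedNorm (fockWeight (m + n)) v := by
  induction n generalizing m with
  | zero => simp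
  | succ n ih =>
    rw [pow_succ', Module.End.mul_apply]
    calc _ ≤ |r| * weightedNorm (fockWeight (m + 1)) ((squeezeGen r θ ^ n) v) :=
          weightedNorm_squeezeGen_le r θ m _
      _ ≤ |r| * (|r| ^ n * weightedNorm (fockWeight (m + 1 + n)) v) := by gcongr; exact ih _
      _ = _ := by rw [add_assoc, add_comm 1 n]; ring

theorem norm_incl_le (v : FiniteVec) : ‖incl ket v‖ ≤ weightedNorm (fockWeight 0) v := by
  rw [incl, Finsupp.linearCombination_apply]
  refine (norm_sum_le _ _).trans (Finset.sum_le_sum fun k _ => ?_)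
  rw [norm_smul, ket.orthonormal.1 k]
  simp [fockWeight]

/-- The growth of `c Kⁿ v` for an operator `c` at most linear in `a, a†`. -/
theorem exists_bound_squeezeGen_pow (r θ : ℝ) {c : Module.End ℂ FiniteVec} {C : ℝ} (hC : 0 ≤ C)
    (hc : ∀ v, weightedNorm (fockWeight 0) (c v) ≤ C * weightedNorm (fockWeight 1) v)
    (v : FiniteVec) :
    ∃ M, ∀ n, ‖incl ket (c ((squeezeGen r θ ^ n) v))‖ ≤ M * (8 * (|r| + 1)) ^ n * n ! := by
  refine ⟨C * 4 * weightedNorm (fun k => 2 ^ k) v, fun n => ?_⟩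
  have hv : 0 ≤ weightedNorm (fun k => 2 ^ k) v := Finset.sum_nonneg fun _ _ => by positivity
  have h1 : weightedNorm (fockWeight (1 + n)) v ≤
      4 ^ (n + 1) * (n + 1)! * weightedNorm (fun k => 2 ^ k) v := by
    rw [add_comm, weightedNorm, weightedNorm, Finsupp.sum, Finsupp.sum, Finset.mul_sum]
    refine Finset.sum_le_sum fun k _ => ?_
    calc ‖v k‖ * fockWeight (n + 1) k ≤ ‖v k‖ * (4 ^ (n + 1) * (n + 1)! * 2 ^ k) := by
          gcongr; exact fockWeight_le _ _
      _ = _ := by ring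
  have h2 : ((n + 1)! : ℝ) ≤ 2 ^ n * n ! := by
    rw [Nat.factorial_succ]
    push_cast
    gcongr
    exact_mod_cast (Nat.lt_two_pow_self (n := n))
  calc _ ≤ weightedNorm (fockWeight 0) (c ((squeezeGen r θ ^ n) v)) := norm_incl_le ket _
    _ ≤ C * (|r| ^ n * weightedNorm (fockWeight (1 + n)) v) :=
      (hc _).trans (by gcongr; exact weightedNorm_squeezeGen_pow_le r θ 1 n v)
    _ ≤ C * ((|r| + 1) ^ n * (4 ^ (n + 1) * (2 ^ n * n !) * weightedNorm (fun k => 2 ^ k) v)) := by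
      have h3 : |r| ^ n ≤ (|r| + 1) ^ n := by gcongr; linarith
      refine mul_le_mul_of_nonneg_left ?_ hC
      refine (mul_le_mul_of_nonneg_left h1 (by positivity)).trans ?_
      gcongr
    _ = _ := by
      rw [mul_pow, show (8 : ℝ) = 4 * 2 by norm_num, mul_pow]; ring

theorem hasAnalyticVectors_squeezeGen (r θ : ℝ) :
    HasAnalyticVectors ket (squeezeGen r θ) (8 * (|r| + 1)) := by
  refine exists_bound_squeezeGen_pow ket r θ (c := 1) zero_le_one fun v => ?_
  refine weightedNorm_map_le (fockWeight_nonneg 0) 1 (fun k c => ?_) v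
  rw [Module.End.one_apply, weightedNorm_single, one_mul]
  gcongr
  have : (0 : ℝ) ≤ k := by positivity
  simp only [fockWeight, Finset.range_zero, Finset.prod_empty, Finset.range_one,
    Finset.prod_singleton, Nat.cast_zero]
  linarith

end Ladder

/-! ### The action of squeezing on the ladder operators -/

section Intertwining

open scoped Nat

variable {H : Type*} [NormedAddCommGroup H] [InnerProductSpace ℂ H] [CompleteSpace H]
  {ket : HilbertBasis ℕ ℂ H}

/-- `A U(t) = U(t) (cosh (rt) A - ζ sinh (rt) B)` in the weak sense, when the commutators with the
generator are `[A, K] = -r ζ B` and `[B, K] = -r ζ⁻¹ A`. -/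
theorem IsUnitaryGroupOf.inner_conj_ladder {r θ : ℝ} {U : ℝ → H →L[ℂ] H}
    (hU : IsUnitaryGroupOf ket (squeezeGen r θ) U) {A A' B : Module.End ℂ FiniteVec} {ζ ζ' : ℂ}
    (hζ : ζ * ζ' = 1) (hA : A * squeezeGen r θ = squeezeGen r θ * A - (r * ζ) • B)
    (hB : B * squeezeGen r θ = squeezeGen r θ * B - (r * ζ') • A)
    (hAA' : ∀ v w, ⟪incl ket v, incl ket (A w)⟫_ℂ = ⟪incl ket (A' v), incl ket w⟫_ℂ)
    (hbA : ∀ v, weightedNorm (fockWeight 0) (A v) ≤ 1 * weightedNorm (fockWeight 1) v)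
    (hbB : ∀ v, weightedNorm (fockWeight 0) (B v) ≤ 1 * weightedNorm (fockWeight 1) v)
    (e v : FiniteVec) {t : ℝ} (ht : 0 ≤ t) :
    (Real.cosh (r * t) : ℂ) * ⟪incl ket e, U t (incl ket (A v))⟫_ℂ
      - ζ * Real.sinh (r * t) * ⟪incl ket e, U t (incl ket (B v))⟫_ℂ
      = ⟪incl ket (A' e), U t (incl ket v)⟫_ℂ := by
  have hAv : ∀ v, A (squeezeGen r θ v) = squeezeGen r θ (A v) - (r * ζ) • B v := fun v =>
    LinearMap.congr_fun hA v
  have hBv : ∀ v, B (squeezeGen r θ v) = squeezeGen r θ (B v) - (r * ζ') • A v := fun v =>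
    LinearMap.congr_fun hB v
  have hin : ∀ (x : H) (v : FiniteVec) (t : ℝ), HasDerivAt (fun t => ⟪x, U t (incl ket v)⟫_ℂ)
      ⟪x, U t (incl ket (squeezeGen r θ v))⟫_ℂ t := fun x v t =>
    ((innerSL ℂ x).restrictScalars ℝ).hasFDerivAt.comp_hasDerivAt t (hU.hasDerivAt_apply v t)
  have hcosh : ∀ t : ℝ, HasDerivAt (fun t : ℝ => (Real.cosh (r * t) : ℂ))
      ((r * Real.sinh (r * t) : ℝ) : ℂ) t := fun t => by
    have h := ((hasDerivAt_id t).const_mul r).cosh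
    exact (h.congr_deriv (by simp; ring)).ofReal_comp
  have hsinh : ∀ t : ℝ, HasDerivAt (fun t : ℝ => (Real.sinh (r * t) : ℂ))
      ((r * Real.cosh (r * t) : ℝ) : ℂ) t := fun t => by
    have h := ((hasDerivAt_id t).const_mul r).sinh
    exact (h.congr_deriv (by simp; ring)).ofReal_comp
  refine sub_eq_zero.1 (eq_zero_of_hasDerivAt_iterate (squeezeGen r θ)
    (fun v t => (Real.cosh (r * t) : ℂ) * ⟪incl ket e, U t (incl ket (A v))⟫_ℂ
      - ζ * Real.sinh (r * t) * ⟪incl ket e, U t (incl ket (B v))⟫_ℂ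
      - ⟪incl ket (A' e), U t (incl ket v)⟫_ℂ) (fun v t => ?_) (fun v => ?_)
    (ρ := 8 * (|r| + 1)) (by positivity) (fun v T => ?_) v t ht)
  · have h := (((hcosh t).mul (hin (incl ket e) (A v) t)).sub
      (((hsinh t).const_mul ζ).mul (hin (incl ket e) (B v) t))).sub (hin (incl ket (A' e)) v t)
    refine h.congr_deriv ?_
    rw [hAv, hBv]
    simp only [map_sub, map_smul, inner_sub_right, inner_smul_right]
    push_cast
    linear_combination (-(r : ℂ) * Complex.sinh (r * t) * ⟪incl ket e, U t (incl ket (A v))⟫_ℂ) * hζ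
  · simp [hU.map_zero, hAA']
  · obtain ⟨M₁, h₁⟩ := exists_bound_squeezeGen_pow ket r θ zero_le_one hbA v
    obtain ⟨M₂, h₂⟩ := exists_bound_squeezeGen_pow ket r θ zero_le_one hbB v
    obtain ⟨M₃, h₃⟩ := hasAnalyticVectors_squeezeGen ket r θ v
    have hU' : ∀ (x : H) (v : FiniteVec) t, ‖⟪x, U t (incl ket v)⟫_ℂ‖ ≤ ‖x‖ * ‖incl ket v‖ :=
      fun x v t => (norm_inner_le_norm _ _).trans_eq (by rw [hU.norm_map])
    refine ⟨Real.cosh (r * T) * (‖incl ket e‖ * M₁) +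
      ‖ζ‖ * Real.cosh (r * T) * (‖incl ket e‖ * M₂) + ‖incl ket (A' e)‖ * M₃, fun n t ht => ?_⟩
    have hc : |Real.cosh (r * t)| ≤ Real.cosh (r * T) := by
      rw [abs_of_pos (Real.cosh_pos _), Real.cosh_le_cosh, abs_mul, abs_mul, abs_of_nonneg ht.1,
        abs_of_nonneg (ht.1.trans ht.2)]
      exact mul_le_mul_of_nonneg_left ht.2 (abs_nonneg r)
    have hs : |Real.sinh (r * t)| ≤ Real.cosh (r * T) := by
      refine le_trans ?_ hc
      rw [abs_of_pos (Real.cosh_pos _), Real.abs_sinh, ← Real.cosh_abs]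
      exact (Real.sinh_lt_cosh _).le
    refine (norm_sub_le _ _).trans ((add_le_add_left (norm_sub_le _ _) _).trans ?_)
    simp only [norm_mul, Complex.norm_real, Real.norm_eq_abs]
    calc _ ≤ Real.cosh (r * T) * (‖incl ket e‖ * (M₁ * (8 * (|r| + 1)) ^ n * n !)) +
          ‖ζ‖ * Real.cosh (r * T) * (‖incl ket e‖ * (M₂ * (8 * (|r| + 1)) ^ n * n !)) +
          ‖incl ket (A' e)‖ * (M₃ * (8 * (|r| + 1)) ^ n * n !) := by
          gcongr
          · exact (hU' _ _ _).trans (by gcongr; exact h₁ n)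
          · exact (hU' _ _ _).trans (by gcongr; exact h₂ n)
          · exact (hU' _ _ _).trans (by gcongr; exact h₃ n)
      _ = _ := by ring

theorem exists_squeezeOp_eq (ket : HilbertBasis ℕ ℂ H) (r θ : ℝ) :
    ∃ U, IsUnitaryGroupOf ket (squeezeGen r θ) U ∧ squeezeOp ket r θ = U 1 := by
  have h : ∃! U, IsUnitaryGroupOf ket (squeezeGen r θ) U :=
    (hasAnalyticVectors_squeezeGen ket r θ).existsUnique (isSkew_squeezeGen ket r θ) (by positivity)
  refine ⟨h.choose, h.choose_spec.1, ?_⟩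
  rw [squeezeOp, ← squeezeGen, opExp, dif_pos h]

theorem opExp_mem_unitary (ket : HilbertBasis ℕ ℂ H) (K : Module.End ℂ FiniteVec) :
    opExp ket K ∈ unitary (H →L[ℂ] H) := by
  rw [opExp]
  split_ifs with h
  · exact h.choose_spec.1.unitary 1
  · exact one_mem _

theorem exists_star_squeezeOp_eq (ket : HilbertBasis ℕ ℂ H) (r θ : ℝ) :
    ∃ U, IsUnitaryGroupOf ket (squeezeGen (-r) θ) U ∧ star (squeezeOp ket r θ) = U 1 := by
  obtain ⟨U, hU, h⟩ := exists_squeezeOp_eq ket r θ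
  refine ⟨fun t => U (-t), by rw [squeezeGen_neg]; exact hU.neg, ?_⟩
  have h1 : U 1 * U (-1) = 1 := by rw [← hU.map_add, add_neg_cancel, hU.map_zero]
  rw [h]
  calc star (U 1) = star (U 1) * (U 1 * U (-1)) := by rw [h1, mul_one]
    _ = U (-1) := by rw [← mul_assoc, (hU.unitary 1).1, one_mul]

/-- `a S† = S† (cosh r a + e^{2iθ} sinh r a†)` in the weak sense. -/
theorem inner_cre_star_squeezeOp (r θ : ℝ) (e v : FiniteVec) :
    ⟪incl ket (cre e), star (squeezeOp ket r θ) (incl ket v)⟫_ℂ =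
      (Real.cosh r : ℂ) * ⟪incl ket e, star (squeezeOp ket r θ) (incl ket (ann v))⟫_ℂ +
      Complex.exp (2 * θ * Complex.I) * Real.sinh r *
        ⟪incl ket e, star (squeezeOp ket r θ) (incl ket (cre v))⟫_ℂ := by
  obtain ⟨U, hU, h⟩ := exists_star_squeezeOp_eq ket r θ
  rw [h, ← hU.inner_conj_ladder (ζ := Complex.exp (2 * θ * Complex.I))
    (ζ' := Complex.exp (-(2 * θ * Complex.I))) (by rw [← Complex.exp_add]; simp)
    (ann_mul_squeezeGen (-r) θ) (cre_mul_squeezeGen (-r) θ) (inner_incl_ann ket)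
    (weightedNorm_ann_le 0) (weightedNorm_cre_le 0) e v zero_le_one]
  simp

/-- `a† S† = S† (cosh r a† + e^{-2iθ} sinh r a)` in the weak sense. -/
theorem inner_ann_star_squeezeOp (r θ : ℝ) (e v : FiniteVec) :
    ⟪incl ket (ann e), star (squeezeOp ket r θ) (incl ket v)⟫_ℂ =
      (Real.cosh r : ℂ) * ⟪incl ket e, star (squeezeOp ket r θ) (incl ket (cre v))⟫_ℂ +
      Complex.exp (-(2 * θ * Complex.I)) * Real.sinh r *
        ⟪incl ket e, star (squeezeOp ket r θ) (incl ket (ann v))⟫_ℂ := by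
  obtain ⟨U, hU, h⟩ := exists_star_squeezeOp_eq ket r θ
  rw [h, ← hU.inner_conj_ladder (ζ := Complex.exp (-(2 * θ * Complex.I)))
    (ζ' := Complex.exp (2 * θ * Complex.I)) (by rw [← Complex.exp_add]; simp)
    (cre_mul_squeezeGen (-r) θ) (ann_mul_squeezeGen (-r) θ) (inner_incl_cre ket)
    (weightedNorm_cre_le 0) (weightedNorm_ann_le 0) e v zero_le_one]
  simp

end Intertwining

/-! ### The generating function of the transition probabilities -/

section GeneratingFunction

/-- `∑ p m n xᵐ yⁿ`. -/
def genFun (p : ℕ → ℕ → ℝ) (x y : ℝ) : ℝ := ∑' k : ℕ × ℕ, p k.1 k.2 * (x ^ k.1 * y ^ k.2)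

/-- The termwise derivative of `genFun` in `x`. -/
def genFunDx (p : ℕ → ℕ → ℝ) (x y : ℝ) : ℝ :=
  ∑' k : ℕ × ℕ, p k.1 k.2 * (k.1 * x ^ (k.1 - 1) * y ^ k.2)

/-- The termwise derivative of `genFun` in `y`. -/
def genFunDy (p : ℕ → ℕ → ℝ) (x y : ℝ) : ℝ :=
  ∑' k : ℕ × ℕ, p k.1 k.2 * (x ^ k.1 * (k.2 * y ^ (k.2 - 1)))

theorem summable_natCast_mul_pow_pred {x : ℝ} (hx : |x| < 1) :
    Summable fun n : ℕ => (n : ℝ) * |x| ^ (n - 1) := by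
  rw [← summable_nat_add_iff 1]
  have h1 : Summable fun n : ℕ => (n : ℝ) * |x| ^ n := by
    simpa using summable_pow_mul_geometric_of_norm_lt_one 1 (r := |x|) (by simpa using hx)
  have h2 : Summable fun n : ℕ => |x| ^ n :=
    summable_geometric_of_lt_one (abs_nonneg x) hx
  refine (h1.add h2).congr fun n => ?_
  simp only [Nat.add_sub_cancel]
  push_cast
  ring

theorem summable_abs_pow {x : ℝ} (hx : |x| < 1) : Summable fun n : ℕ => |x| ^ n :=
  summable_geometric_of_lt_one (abs_nonneg x) hx

theorem hasFDerivAt_monomial (c : ℝ) (m n : ℕ) (z : ℝ × ℝ) :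
    HasFDerivAt (fun z : ℝ × ℝ => c * (z.1 ^ m * z.2 ^ n))
      ((c * (m * z.1 ^ (m - 1) * z.2 ^ n)) • ContinuousLinearMap.fst ℝ ℝ ℝ +
        (c * (z.1 ^ m * (n * z.2 ^ (n - 1)))) • ContinuousLinearMap.snd ℝ ℝ ℝ) z := by
  have h1 : HasFDerivAt (fun z : ℝ × ℝ => z.1 ^ m)
      ((m * z.1 ^ (m - 1)) • ContinuousLinearMap.fst ℝ ℝ ℝ) z :=
    (hasDerivAt_pow m z.1).comp_hasFDerivAt z (hasFDerivAt_fst (𝕜 := ℝ) (p := z))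
  have h2 : HasFDerivAt (fun z : ℝ × ℝ => z.2 ^ n)
      ((n * z.2 ^ (n - 1)) • ContinuousLinearMap.snd ℝ ℝ ℝ) z :=
    (hasDerivAt_pow n z.2).comp_hasFDerivAt z (hasFDerivAt_snd (𝕜 := ℝ) (p := z))
  refine ((h1.mul h2).const_mul c).congr_fderiv ?_
  refine ContinuousLinearMap.ext fun w => ?_
  simp only [add_apply, smul_apply, ContinuousLinearMap.coe_fst', ContinuousLinearMap.coe_snd',
    smul_eq_mul]
  ring

theorem summable_genFun {p : ℕ → ℕ → ℝ} (hp : ∀ m n, |p m n| ≤ 1)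
    {x y : ℝ} (hx : |x| < 1) (hy : |y| < 1) :
    Summable fun k : ℕ × ℕ => p k.1 k.2 * (x ^ k.1 * y ^ k.2) := by
  refine Summable.of_norm_bounded ((summable_abs_pow hx).mul_of_nonneg (summable_abs_pow hy)
    (fun _ => by positivity) fun _ => by positivity) fun k => ?_
  rw [norm_mul, norm_mul, norm_pow, norm_pow]
  simp only [Real.norm_eq_abs]
  exact mul_le_of_le_one_left (by positivity) (hp _ _)

theorem norm_genFunDx_term_le {p : ℕ → ℕ → ℝ} (hp : ∀ m n, |p m n| ≤ 1)
    (x y : ℝ) (k : ℕ × ℕ) :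
    ‖p k.1 k.2 * (k.1 * x ^ (k.1 - 1) * y ^ k.2)‖ ≤ k.1 * |x| ^ (k.1 - 1) * |y| ^ k.2 := by
  simp only [norm_mul, norm_pow, Real.norm_eq_abs, Nat.abs_cast]
  exact mul_le_of_le_one_left (by positivity) (hp _ _)

theorem norm_genFunDy_term_le {p : ℕ → ℕ → ℝ} (hp : ∀ m n, |p m n| ≤ 1)
    (x y : ℝ) (k : ℕ × ℕ) :
    ‖p k.1 k.2 * (x ^ k.1 * (k.2 * y ^ (k.2 - 1)))‖ ≤ |x| ^ k.1 * (k.2 * |y| ^ (k.2 - 1)) := by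
  simp only [norm_mul, norm_pow, Real.norm_eq_abs, Nat.abs_cast]
  exact mul_le_of_le_one_left (by positivity) (hp _ _)

theorem summable_genFunDx {p : ℕ → ℕ → ℝ} (hp : ∀ m n, |p m n| ≤ 1)
    {x y : ℝ} (hx : |x| < 1) (hy : |y| < 1) :
    Summable fun k : ℕ × ℕ => p k.1 k.2 * (k.1 * x ^ (k.1 - 1) * y ^ k.2) :=
  Summable.of_norm_bounded ((summable_natCast_mul_pow_pred hx).mul_of_nonneg (summable_abs_pow hy)
    (fun _ => by positivity) fun _ => by positivity) (norm_genFunDx_term_le hp x y)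

theorem summable_genFunDy {p : ℕ → ℕ → ℝ} (hp : ∀ m n, |p m n| ≤ 1)
    {x y : ℝ} (hx : |x| < 1) (hy : |y| < 1) :
    Summable fun k : ℕ × ℕ => p k.1 k.2 * (x ^ k.1 * (k.2 * y ^ (k.2 - 1))) :=
  Summable.of_norm_bounded ((summable_abs_pow hx).mul_of_nonneg (summable_natCast_mul_pow_pred hy)
    (fun _ => by positivity) fun _ => by positivity) (norm_genFunDy_term_le hp x y)

theorem hasFDerivAt_genFun {p : ℕ → ℕ → ℝ} (hp : ∀ m n, |p m n| ≤ 1)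
    {x y : ℝ} (hx : |x| < 1) (hy : |y| < 1) :
    HasFDerivAt (fun z : ℝ × ℝ => genFun p z.1 z.2)
      (genFunDx p x y • ContinuousLinearMap.fst ℝ ℝ ℝ +
        genFunDy p x y • ContinuousLinearMap.snd ℝ ℝ ℝ) (x, y) := by
  obtain ⟨ρ, hρ, hρ1⟩ := exists_between (max_lt hx hy)
  have hρ0 : 0 ≤ ρ := (abs_nonneg x).trans ((le_max_left _ _).trans hρ.le)
  have hρa : |ρ| < 1 := by rwa [abs_of_nonneg hρ0]
  let u : ℕ × ℕ → ℝ := fun k =>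
    k.1 * |ρ| ^ (k.1 - 1) * |ρ| ^ k.2 + |ρ| ^ k.1 * (k.2 * |ρ| ^ (k.2 - 1))
  have hu : Summable u :=
    ((summable_natCast_mul_pow_pred hρa).mul_of_nonneg (summable_abs_pow hρa)
      (fun _ => by positivity) fun _ => by positivity).add
    ((summable_abs_pow hρa).mul_of_nonneg (summable_natCast_mul_pow_pred hρa)
      (fun _ => by positivity) fun _ => by positivity)
  set g' : ℕ × ℕ → ℝ × ℝ → (ℝ × ℝ →L[ℝ] ℝ) := fun k z =>
    (p k.1 k.2 * (k.1 * z.1 ^ (k.1 - 1) * z.2 ^ k.2)) • ContinuousLinearMap.fst ℝ ℝ ℝ +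
    (p k.1 k.2 * (z.1 ^ k.1 * (k.2 * z.2 ^ (k.2 - 1)))) • ContinuousLinearMap.snd ℝ ℝ ℝ with hg'
  have hball : ∀ z : ℝ × ℝ, z ∈ Metric.ball (0 : ℝ × ℝ) ρ → |z.1| ≤ |ρ| ∧ |z.2| ≤ |ρ| := by
    intro z hz
    rw [mem_ball_zero_iff, Prod.norm_def, max_lt_iff] at hz
    rw [abs_of_nonneg hρ0]
    exact ⟨hz.1.le, hz.2.le⟩
  have hz : ((x, y) : ℝ × ℝ) ∈ Metric.ball (0 : ℝ × ℝ) ρ := by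
    rw [mem_ball_zero_iff, Prod.norm_def]; exact hρ
  have hbound : ∀ k z, z ∈ Metric.ball (0 : ℝ × ℝ) ρ → ‖g' k z‖ ≤ u k := by
    intro k z hz
    obtain ⟨hz1, hz2⟩ := hball z hz
    refine (norm_add_le _ _).trans (add_le_add ?_ ?_)
    · rw [norm_smul]
      refine (mul_le_of_le_one_right (norm_nonneg _) (ContinuousLinearMap.norm_fst_le ℝ ℝ ℝ)).trans
        ((norm_genFunDx_term_le hp _ _ _).trans ?_)
      gcongr
    · rw [norm_smul]
      refine (mul_le_of_le_one_right (norm_nonneg _) (ContinuousLinearMap.norm_snd_le ℝ ℝ ℝ)).trans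
        ((norm_genFunDy_term_le hp _ _ _).trans ?_)
      gcongr
  have e1 : HasSum (fun k => g' k (x, y)) (genFunDx p x y • ContinuousLinearMap.fst ℝ ℝ ℝ +
        genFunDy p x y • ContinuousLinearMap.snd ℝ ℝ ℝ) :=
    (((summable_genFunDx hp hx hy).hasSum.smul_const (ContinuousLinearMap.fst ℝ ℝ ℝ))).add
      ((summable_genFunDy hp hx hy).hasSum.smul_const (ContinuousLinearMap.snd ℝ ℝ ℝ))
  rw [← e1.tsum_eq]
  exact hasFDerivAt_tsum_of_isPreconnected (𝕜 := ℝ)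
    (f := fun (k : ℕ × ℕ) (z : ℝ × ℝ) => p k.1 k.2 * (z.1 ^ k.1 * z.2 ^ k.2)) (f' := g')
    (x := ((x, y) : ℝ × ℝ)) (x₀ := (x, y)) hu Metric.isOpen_ball
    (convex_ball (0 : ℝ × ℝ) ρ).isPreconnected (fun k z _ => hasFDerivAt_monomial _ _ _ z) hbound
    hz (summable_genFun hp hx hy) hz

theorem hasSum_shift_left {f : ℕ × ℕ → ℝ} (h0 : ∀ n, f (0, n) = 0) {s : ℝ} :
    HasSum (fun k : ℕ × ℕ => f (k.1 + 1, k.2)) s ↔ HasSum f s := by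
  have hinj : Function.Injective fun k : ℕ × ℕ => (k.1 + 1, k.2) := fun a b h => by
    simp only [Prod.mk.injEq, add_left_inj] at h
    exact Prod.ext h.1 h.2
  refine hinj.hasSum_iff fun k hk => ?_
  obtain ⟨m, n⟩ := k
  rcases m with _ | m
  · exact h0 n
  · exact absurd ⟨(m, n), rfl⟩ hk

theorem hasSum_shift_right {f : ℕ × ℕ → ℝ} (h0 : ∀ m, f (m, 0) = 0) {s : ℝ} :
    HasSum (fun k : ℕ × ℕ => f (k.1, k.2 + 1)) s ↔ HasSum f s := by
  have hinj : Function.Injective fun k : ℕ × ℕ => (k.1, k.2 + 1) := fun a b h => by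
    simp only [Prod.mk.injEq, add_left_inj] at h
    exact Prod.ext h.1 h.2
  refine hinj.hasSum_iff fun k hk => ?_
  obtain ⟨m, n⟩ := k
  rcases n with _ | n
  · exact h0 m
  · exact absurd ⟨(m, n), rfl⟩ hk

theorem natCast_mul_pow_pred (x : ℝ) (m : ℕ) : x * (m * x ^ (m - 1)) = m * x ^ m := by
  rcases m with _ | m
  · simp
  · simp only [Nat.add_sub_cancel]; ring

theorem hasSum_succ_mul_left {p : ℕ → ℕ → ℝ} (hp : ∀ m n, |p m n| ≤ 1)
    {x y : ℝ} (hx : |x| < 1) (hy : |y| < 1) :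
    HasSum (fun k : ℕ × ℕ => (k.1 + 1) * p (k.1 + 1) k.2 * (x ^ k.1 * y ^ k.2))
      (genFunDx p x y) := by
  refine ((hasSum_shift_left (by simp)).2 (summable_genFunDx hp hx hy).hasSum).congr_fun fun k => ?_
  simp only [Nat.add_sub_cancel]
  push_cast
  ring

theorem hasSum_succ_mul_right {p : ℕ → ℕ → ℝ} (hp : ∀ m n, |p m n| ≤ 1)
    {x y : ℝ} (hx : |x| < 1) (hy : |y| < 1) :
    HasSum (fun k : ℕ × ℕ => (k.2 + 1) * p k.1 (k.2 + 1) * (x ^ k.1 * y ^ k.2))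
      (genFunDy p x y) := by
  refine ((hasSum_shift_right (by simp)).2 (summable_genFunDy hp hx hy).hasSum).congr_fun
    fun k => ?_
  simp only [Nat.add_sub_cancel]
  push_cast
  ring

theorem hasSum_mul_pred_left {p : ℕ → ℕ → ℝ} (hp : ∀ m n, |p m n| ≤ 1)
    {x y : ℝ} (hx : |x| < 1) (hy : |y| < 1) :
    HasSum (fun k : ℕ × ℕ => k.1 * p (k.1 - 1) k.2 * (x ^ k.1 * y ^ k.2))
      (x ^ 2 * genFunDx p x y + x * genFun p x y) := by
  refine (hasSum_shift_left (by simp)).1 ?_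
  refine (((summable_genFunDx hp hx hy).hasSum.mul_left (x ^ 2)).add
    ((summable_genFun hp hx hy).hasSum.mul_left x)).congr_fun fun k => ?_
  simp only [Nat.add_sub_cancel]
  push_cast
  linear_combination (-x * y ^ k.2 * p k.1 k.2) * natCast_mul_pow_pred x k.1

theorem hasSum_mul_pred_right {p : ℕ → ℕ → ℝ} (hp : ∀ m n, |p m n| ≤ 1)
    {x y : ℝ} (hx : |x| < 1) (hy : |y| < 1) :
    HasSum (fun k : ℕ × ℕ => k.2 * p k.1 (k.2 - 1) * (x ^ k.1 * y ^ k.2))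
      (y ^ 2 * genFunDy p x y + y * genFun p x y) := by
  refine (hasSum_shift_right (by simp)).1 ?_
  refine (((summable_genFunDy hp hx hy).hasSum.mul_left (y ^ 2)).add
    ((summable_genFun hp hx hy).hasSum.mul_left y)).congr_fun fun k => ?_
  simp only [Nat.add_sub_cancel]
  push_cast
  linear_combination (-y * x ^ k.1 * p k.1 k.2) * natCast_mul_pow_pred y k.2

/-- The recurrence of the transition probabilities as a first-order partial differential
equation for the generating function. -/
theorem genFun_pde {p : ℕ → ℕ → ℝ} (hp : ∀ m n, |p m n| ≤ 1)
    (hrec : ∀ m n : ℕ, n * p m (n - 1) - (n + 1) * p m (n + 1) =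
      (m + 1) * p (m + 1) n - m * p (m - 1) n) {x y : ℝ} (hx : |x| < 1) (hy : |y| < 1) :
    (1 - x ^ 2) * genFunDx p x y + (1 - y ^ 2) * genFunDy p x y = (x + y) * genFun p x y := by
  have h1 := (hasSum_mul_pred_right hp hx hy).sub (hasSum_succ_mul_right hp hx hy)
  have h2 := (hasSum_succ_mul_left hp hx hy).sub (hasSum_mul_pred_left hp hx hy)
  have h3 := h1.unique (h2.congr_fun fun k => by rw [← sub_mul, hrec, sub_mul])
  linarith

/-- The recurrence along the row `m = 0` as a differential equation. -/
theorem genFun_ode {p : ℕ → ℕ → ℝ} (hp : ∀ m n, |p m n| ≤ 1)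
    {lam : ℝ} (hrow : ∀ n : ℕ, (n + 1) * p 0 (n + 1) = lam * (n * p 0 (n - 1)))
    {y : ℝ} (hy : |y| < 1) :
    (1 - lam * y ^ 2) * genFunDy p 0 y = lam * y * genFun p 0 y := by
  have h0 : |(0 : ℝ)| < 1 := by simp
  have h1 := hasSum_succ_mul_right hp h0 hy
  have h2 := (hasSum_mul_pred_right hp h0 hy).mul_left lam
  have h3 := h1.unique (h2.congr_fun fun k => by
    rcases Nat.eq_zero_or_pos k.1 with h | h
    · rw [h, hrow]; ring
    · rw [zero_pow h.ne']; ring)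
  linarith

theorem eq_of_hasDerivAt_zero {h : ℝ → ℝ} (hd : ∀ t, |t| < 1 → HasDerivAt h 0 t) {s t : ℝ}
    (hs : |s| < 1) (ht : |t| < 1) : h s = h t :=
  isOpen_Ioo.is_const_of_deriv_eq_zero (isPreconnected_Ioo (a := (-1 : ℝ)) (b := 1))
    (fun x hx => (hd x (abs_lt.2 hx)).differentiableAt.differentiableWithinAt)
    (fun x hx => (hd x (abs_lt.2 hx)).deriv) (abs_lt.1 hs) (abs_lt.1 ht)

/-- Along the row `m = 0` the differential equation is solved by normalizing at `y = 1`. -/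
theorem genFun_zero_sq {p : ℕ → ℕ → ℝ} (hp : ∀ m n, |p m n| ≤ 1)
    {lam : ℝ}
    (hrow : ∀ n : ℕ, (n + 1) * p 0 (n + 1) = lam * (n * p 0 (n - 1)))
    (hnorm : HasSum (p 0) 1) {y : ℝ} (hy : |y| < 1) :
    genFun p 0 y ^ 2 * (1 - lam * y ^ 2) = 1 - lam := by
  have h0 : |(0 : ℝ)| < 1 := by simp
  have hconst : ∀ t, |t| < 1 → HasDerivAt (fun y => genFun p 0 y ^ 2 * (1 - lam * y ^ 2)) 0 t := by
    intro t ht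
    have h1 : HasDerivAt (fun y => genFun p 0 y) (genFunDy p 0 t) t := by
      have := (hasFDerivAt_genFun hp h0 ht).comp_hasDerivAt t
        ((hasDerivAt_const t (0 : ℝ)).prodMk (hasDerivAt_id t))
      simpa [Function.comp_def] using this
    have h2 : HasDerivAt (fun y : ℝ => 1 - lam * y ^ 2) (-(lam * (2 * t))) t := by
      simpa using ((hasDerivAt_pow 2 t).const_mul lam).const_sub 1
    refine ((h1.pow 2).mul h2).congr_deriv ?_
    have := genFun_ode hp hrow ht
    simp
    linear_combination 2 * genFun p 0 t * this
  have hval : ∀ t, |t| < 1 → genFun p 0 t = ∑' n, p 0 n * t ^ n := by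
    intro t ht
    have hinj : Function.Injective fun n : ℕ => ((0, n) : ℕ × ℕ) := fun a b h => by simpa using h
    have := (hinj.hasSum_iff (f := fun k : ℕ × ℕ => p k.1 k.2 * (0 ^ k.1 * t ^ k.2)) (fun k hk => by
      have hk0 : k.1 ≠ 0 := fun h => hk ⟨k.2, Prod.ext h.symm rfl⟩
      simp [zero_pow hk0])).2 (summable_genFun hp h0 ht).hasSum
    rw [genFun, ← this.tsum_eq]
    simp
  have hlim := Real.tendsto_tsum_powerSeries_nhdsWithin_lt hnorm.tendsto_sum_nat
  have hlim2 : Tendsto (fun t => genFun p 0 t ^ 2 * (1 - lam * t ^ 2)) (𝓝[<] 1)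
      (𝓝 (1 ^ 2 * (1 - lam * 1 ^ 2))) := by
    refine Tendsto.mul (Tendsto.pow ?_ 2) ?_
    · refine hlim.congr' ?_
      filter_upwards [Ioo_mem_nhdsLT (show (-1 : ℝ) < 1 by norm_num)] with t ht
      exact (hval t (abs_lt.2 ht)).symm
    · exact ((by fun_prop : Continuous fun t : ℝ => 1 - lam * t ^ 2).tendsto 1).mono_left
        nhdsWithin_le_nhds
  have hlim3 : Tendsto (fun t => genFun p 0 t ^ 2 * (1 - lam * t ^ 2)) (𝓝[<] 1)
      (𝓝 (genFun p 0 y ^ 2 * (1 - lam * y ^ 2))) := by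
    refine tendsto_const_nhds.congr' ?_
    filter_upwards [Ioo_mem_nhdsLT (show (-1 : ℝ) < 1 by norm_num)] with t ht
    exact eq_of_hasDerivAt_zero hconst hy (abs_lt.2 ht)
  rw [tendsto_nhds_unique hlim3 hlim2]
  ring

/-- The generating function of the transition probabilities, found by the method of
characteristics: `genFun² (1 - x²) (1 - y²)` is constant along the curves on which
`(y - x) / (1 - x y)` is constant, and each of them meets the line `x = 0`. -/
theorem genFun_sq {p : ℕ → ℕ → ℝ} (hp : ∀ m n, |p m n| ≤ 1)
    {lam : ℝ} (hrec : ∀ m n : ℕ, n * p m (n - 1) - (n + 1) * p m (n + 1) =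
      (m + 1) * p (m + 1) n - m * p (m - 1) n)
    (hrow : ∀ n : ℕ, (n + 1) * p 0 (n + 1) = lam * (n * p 0 (n - 1)))
    (hnorm : HasSum (p 0) 1) {x y : ℝ} (hx : |x| < 1) (hy : |y| < 1) :
    genFun p x y ^ 2 * ((1 - x * y) ^ 2 - lam * (y - x) ^ 2) = 1 - lam := by
  have hxy : 0 < 1 - x * y := by
    have : |x * y| < 1 := by
      rw [abs_mul]; exact mul_lt_one_of_nonneg_of_lt_one_left (abs_nonneg _) hx hy.le
    linarith [(abs_lt.1 this).2]
  have hx2 : 0 < 1 - x ^ 2 := by have := (sq_lt_one_iff_abs_lt_one x).2 hx; linarith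
  have hy2 : 0 < 1 - y ^ 2 := by have := (sq_lt_one_iff_abs_lt_one y).2 hy; linarith
  have hne := hxy.ne'
  obtain ⟨w, hw⟩ : ∃ w, w * (1 - x * y) = y - x := ⟨_, div_mul_cancel₀ _ hne⟩
  have hw1 : 1 - w ^ 2 = (1 - x ^ 2) * (1 - y ^ 2) / (1 - x * y) ^ 2 := by
    rw [eq_div_iff (by positivity)]
    linear_combination (-(w * (1 - x * y) + (y - x))) * hw
  have hw2 : 0 < 1 - w ^ 2 := by rw [hw1]; positivity
  have hwa : |w| < 1 := (sq_lt_one_iff_abs_lt_one w).1 (by linarith)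
  have hden : ∀ t, |t| < 1 → 0 < 1 + w * t := by
    intro t ht
    have : |w * t| < 1 := by
      rw [abs_mul]; exact mul_lt_one_of_nonneg_of_lt_one_left (abs_nonneg _) hwa ht.le
    linarith [(abs_lt.1 this).1]
  let Y : ℝ → ℝ := fun t => (w + t) / (1 + w * t)
  have hY1 : ∀ t, |t| < 1 → 1 - Y t ^ 2 = (1 - w ^ 2) * (1 - t ^ 2) / (1 + w * t) ^ 2 := by
    intro t ht
    have := (hden t ht).ne'
    simp only [Y]; field_simp; ring
  have hYa : ∀ t, |t| < 1 → |Y t| < 1 := by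
    intro t ht
    have h1 : 0 < 1 - t ^ 2 := by have := (sq_lt_one_iff_abs_lt_one t).2 ht; linarith
    have h2 : 0 < 1 - Y t ^ 2 := by
      rw [hY1 t ht]; have := hden t ht; positivity
    exact (sq_lt_one_iff_abs_lt_one _).1 (by linarith)
  have hconst : ∀ t, |t| < 1 →
      HasDerivAt (fun t => genFun p t (Y t) ^ 2 * ((1 - t ^ 2) * (1 - Y t ^ 2))) 0 t := by
    intro t ht
    have hd := (hden t ht).ne'
    have hY : HasDerivAt Y ((1 - w ^ 2) / (1 + w * t) ^ 2) t := by
      have := ((hasDerivAt_id t).const_add w).div (((hasDerivAt_id t).const_mul w).const_add 1) hd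
      refine this.congr_deriv ?_
      simp only [id]; ring
    have h1 : HasDerivAt (fun t => genFun p t (Y t)) (genFunDx p t (Y t) +
        genFunDy p t (Y t) * ((1 - w ^ 2) / (1 + w * t) ^ 2)) t := by
      have := (hasFDerivAt_genFun hp ht (hYa t ht)).comp_hasDerivAt t ((hasDerivAt_id t).prodMk hY)
      simpa [Function.comp_def] using this
    have h2 : HasDerivAt (fun t : ℝ => 1 - t ^ 2) (-(2 * t)) t := by
      simpa using (hasDerivAt_pow 2 t).const_sub 1
    have h3 : HasDerivAt (fun t : ℝ => 1 - Y t ^ 2)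
        (-(2 * Y t * ((1 - w ^ 2) / (1 + w * t) ^ 2))) t := by
      simpa using (hY.pow 2).const_sub 1
    refine ((h1.pow 2).mul (h2.mul h3)).congr_deriv ?_
    have hpde := genFun_pde hp hrec ht (hYa t ht)
    have hYt : (1 - w ^ 2) / (1 + w * t) ^ 2 * (1 - t ^ 2) = 1 - Y t ^ 2 := by
      rw [hY1 t ht]; ring
    simp
    generalize (1 - w ^ 2) / (1 + w * t) ^ 2 = Y' at hYt
    generalize genFunDx p t (Y t) = Fx at *
    generalize genFunDy p t (Y t) = Fy at *
    generalize genFun p t (Y t) = F at *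
    linear_combination 2 * F * (1 - Y t ^ 2) * hpde + (2 * F * (1 - Y t ^ 2) * Fy
      - 2 * F ^ 2 * Y t) * hYt
  have h0 : |(0 : ℝ)| < 1 := by simp
  have h1 := eq_of_hasDerivAt_zero hconst hx h0
  have hY0 : Y 0 = w := by simp [Y]
  have hYx : Y x = y := by
    have hd := hden x hx
    have h2 : 1 + w * x = (1 - x ^ 2) / (1 - x * y) := by
      rw [eq_div_iff hne]; linear_combination x * hw
    have h3 : w + x = y * ((1 - x ^ 2) / (1 - x * y)) := by
      rw [← mul_div_assoc, eq_div_iff hne]; linear_combination hw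
    have h4 := hd.ne'
    rw [h2] at h4
    simp only [Y]
    rw [h3, h2, mul_div_assoc, div_self h4, mul_one]
  simp only [hY0, hYx] at h1
  have h2 := genFun_zero_sq hp hrow hnorm hwa
  have h3 : genFun p x y ^ 2 * (1 - x * y) ^ 2 = genFun p 0 w ^ 2 := by
    have : genFun p x y ^ 2 * (1 - x * y) ^ 2 * (1 - w ^ 2) = genFun p 0 w ^ 2 * (1 - w ^ 2) := by
      rw [hw1]
      rw [hw1] at h1
      calc _ = genFun p x y ^ 2 * ((1 - x ^ 2) * (1 - y ^ 2)) := by field_simp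
        _ = _ := by rw [h1]; ring
    exact mul_right_cancel₀ hw2.ne' this
  rw [← h2, ← h3]
  linear_combination genFun p x y ^ 2 * lam * (w * (1 - x * y) + (y - x)) * hw

end GeneratingFunction

/-! ### Diagonal operators, their powers, and traces -/

section Diagonal

variable {H : Type*} [NormedAddCommGroup H] [InnerProductSpace ℂ H]

theorem mem_spectrum_of_eigenvector {T : H →L[ℂ] H} {x : H} {c : ℝ} (hx : T x = (c : ℂ) • x)
    (hx0 : x ≠ 0) : c ∈ spectrum ℝ T := by
  rw [spectrum.mem_iff]
  intro h
  obtain ⟨u, hu⟩ := h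
  have h1 : (u : H →L[ℂ] H) x = 0 := by
    rw [hu, sub_apply, hx, Algebra.algebraMap_eq_smul_one, smul_apply, one_apply_eq_self,
      Complex.coe_smul, sub_self]
  have h2 : (↑u⁻¹ : H →L[ℂ] H) ((u : H →L[ℂ] H) x) = x := by
    rw [← mul_apply_eq_comp, Units.inv_mul, one_apply_eq_self]
  rw [h1, map_zero] at h2
  exact hx0 h2.symm

theorem hasSum_inner_smul (b : HilbertBasis ℕ ℂ H) (x : H) :
    HasSum (fun n => ⟪b n, x⟫_ℂ • b n) x := by
  simpa only [b.repr_apply_apply] using b.hasSum_repr x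

theorem HasTrace.trace_eq {T : H →L[ℂ] H} {z : ℂ} (h : HasTrace T z) (ket : HilbertBasis ℕ ℂ H) :
    trace ket T = z :=
  (h ket).tsum_eq

/-- `T` is diagonal in the orthonormal basis `b`, with real eigenvalues `c`. -/
def IsDiag (b : HilbertBasis ℕ ℂ H) (c : ℕ → ℝ) (T : H →L[ℂ] H) : Prop :=
  ∀ n, T (b n) = (c n : ℂ) • b n

variable {b g : HilbertBasis ℕ ℂ H} {c d : ℕ → ℝ} {T A B : H →L[ℂ] H}

theorem IsDiag.hasSum_apply (h : IsDiag b c T) (x : H) :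
    HasSum (fun n => ((c n : ℂ) * ⟪b n, x⟫_ℂ) • b n) (T x) := by
  refine ((hasSum_inner_smul b x).mapL T).congr_fun fun n => ?_
  rw [map_smul, h n, smul_smul, mul_comm]

theorem IsDiag.hasSum_inner (h : IsDiag b c T) (x : H) :
    HasSum (fun n => c n * ‖⟪b n, x⟫_ℂ‖ ^ 2) (⟪x, T x⟫_ℂ).re ∧
      (((⟪x, T x⟫_ℂ).re : ℝ) : ℂ) = ⟪x, T x⟫_ℂ := by
  have h1 : HasSum (fun n => ((c n * ‖⟪b n, x⟫_ℂ‖ ^ 2 : ℝ) : ℂ)) ⟪x, T x⟫_ℂ := by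
    refine ((h.hasSum_apply x).mapL (innerSL ℂ x)).congr_fun fun n => ?_
    rw [innerSL_apply_apply, inner_smul_right, mul_assoc, ← inner_conj_symm x, Complex.mul_conj,
      Complex.normSq_eq_norm_sq]
    push_cast
    rfl
  have h2 : HasSum (fun n => c n * ‖⟪b n, x⟫_ℂ‖ ^ 2) (⟪x, T x⟫_ℂ).re := by
    simpa only [Complex.ofReal_re] using Complex.hasSum_re h1
  exact ⟨h2, (Complex.hasSum_ofReal.2 h2).unique h1⟩

theorem tsum_norm_inner_sq (b : HilbertBasis ℕ ℂ H) {x : H} (hx : ‖x‖ = 1) :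
    HasSum (fun n => ‖⟪b n, x⟫_ℂ‖ ^ 2) 1 := by
  have h := (IsDiag.hasSum_inner (b := b) (c := fun _ => 1) (T := 1) (fun n => by simp) x).1
  simpa [inner_self_eq_norm_sq_to_K, hx] using h

/-- An absolutely convergent sum of rank-one operators is trace class. -/
theorem hasTrace_of_hasSum_rankOne {a : ℕ → ℝ} (ha : ∀ m, 0 ≤ a m) {u v : ℕ → H}
    (hT : ∀ x, HasSum (fun m => ((a m : ℂ) * ⟪v m, x⟫_ℂ) • u m) (T x))
    (hs : Summable fun m => a m * (‖u m‖ ^ 2 + ‖v m‖ ^ 2)) :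
    HasTrace T (∑' m, (a m : ℂ) * ⟪v m, u m⟫_ℂ) := by
  intro e
  have hparseval : ∀ x : H, HasSum (fun i => ‖⟪e i, x⟫_ℂ‖ ^ 2) (‖x‖ ^ 2) := by
    intro x
    have h := (IsDiag.hasSum_inner (b := e) (c := fun _ => 1) (T := 1) (fun n => by simp) x).1
    simpa [inner_self_eq_norm_sq_to_K, ← Complex.ofReal_pow] using h
  let F : ℕ × ℕ → ℂ := fun k => (a k.1 : ℂ) * (⟪v k.1, e k.2⟫_ℂ * ⟪e k.2, u k.1⟫_ℂ)
  have hF : Summable F := by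
    let G : ℕ × ℕ → ℝ := fun k => a k.1 * (‖⟪e k.2, u k.1⟫_ℂ‖ ^ 2 + ‖⟪e k.2, v k.1⟫_ℂ‖ ^ 2)
    have hfib : ∀ m, HasSum (fun i => G (m, i)) (a m * (‖u m‖ ^ 2 + ‖v m‖ ^ 2)) := fun m =>
      ((hparseval (u m)).add (hparseval (v m))).mul_left (a m)
    have hG : Summable G := by
      rw [summable_prod_of_nonneg fun k => mul_nonneg (ha _) (by positivity)]
      exact ⟨fun m => (hfib m).summable, hs.congr fun m => (hfib m).tsum_eq.symm⟩
    refine Summable.of_norm_bounded hG fun k => ?_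
    simp only [F, G, norm_mul, Complex.norm_real, Real.norm_eq_abs, abs_of_nonneg (ha _)]
    refine mul_le_mul_of_nonneg_left ?_ (ha _)
    rw [norm_inner_symm (v k.1)]
    nlinarith [sq_nonneg (‖⟪e k.2, v k.1⟫_ℂ‖ - ‖⟪e k.2, u k.1⟫_ℂ‖),
      sq_nonneg (‖⟪e k.2, v k.1⟫_ℂ‖ + ‖⟪e k.2, u k.1⟫_ℂ‖)]
  have h1 : ∑' m, (a m : ℂ) * ⟪v m, u m⟫_ℂ = ∑' k, F k := by
    rw [hF.tsum_prod]
    refine tsum_congr fun m => ?_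
    exact ((e.hasSum_inner_mul_inner (v m) (u m)).mul_left (a m : ℂ)).tsum_eq.symm
  have hF' : HasSum (fun k : ℕ × ℕ => F k.swap) (∑' k, F k) :=
    (Equiv.prodComm ℕ ℕ).hasSum_iff.2 hF.hasSum
  rw [h1]
  refine hF'.prod_fiberwise fun i => ?_
  refine ((hT (e i)).mapL (innerSL ℂ (e i))).congr_fun fun m => ?_
  rw [innerSL_apply_apply, inner_smul_right]
  simp only [F, Prod.swap_prod_mk]
  ring

theorem IsDiag.nonneg (h : IsDiag b c T) (hc : ∀ n, 0 ≤ c n) : 0 ≤ T := by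
  rw [ContinuousLinearMap.nonneg_iff_isPositive, ContinuousLinearMap.isPositive_iff_complex]
  intro x
  obtain ⟨h1, h2⟩ := h.hasSum_inner x
  have h3 : ⟪T x, x⟫_ℂ = ⟪x, T x⟫_ℂ := by
    rw [← inner_conj_symm, ← h2, Complex.conj_ofReal]
  rw [h3]
  exact ⟨h2, h1.nonneg fun n => mul_nonneg (hc n) (by positivity)⟩

theorem IsDiag.hasTrace_mul_right (hA : IsDiag b c A) (hB : IsDiag g d B)
    (hd : ∀ n, 0 ≤ d n) (hs : Summable d) :
    HasTrace (A * B) ((∑' n, d n * ∑' m, c m * ‖⟪b m, g n⟫_ℂ‖ ^ 2 : ℝ) : ℂ) := by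
  have h := hasTrace_of_hasSum_rankOne (T := A * B) hd (u := fun n => A (g n)) (v := g)
    (fun x => ((hB.hasSum_apply x).mapL A).congr_fun fun n => by rw [map_smul]) ?_
  · convert! h using 1
    push_cast
    refine tsum_congr fun n => ?_
    obtain ⟨h1, h2⟩ := hA.hasSum_inner (g n)
    rw [← h2, ← h1.tsum_eq]
    push_cast
    rfl
  · refine Summable.of_nonneg_of_le (fun m => mul_nonneg (hd m) (by positivity)) (fun m => ?_)
      (hs.mul_right (‖A‖ ^ 2 + 1))
    have h1 : ‖g m‖ = 1 := g.orthonormal.1 m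
    have h2 : ‖A (g m)‖ ≤ ‖A‖ := by simpa [h1] using A.le_opNorm (g m)
    have := hd m
    rw [h1, one_pow]
    gcongr

variable [CompleteSpace H]

/-- The continuous functional calculus acts on an eigenvector through the eigenvalue. -/
theorem cfc_apply_of_eigenvector (hT : IsSelfAdjoint T) {x : H} {c : ℝ}
    (hx : T x = (c : ℂ) • x) (hx0 : x ≠ 0) {f : ℝ → ℝ} (hf : ContinuousOn f (spectrum ℝ T)) :
    cfc f T x = (f c : ℂ) • x := by
  have hc := mem_spectrum_of_eigenvector hx hx0
  have key : ∀ g : C(spectrum ℝ T, ℝ), cfcHom (R := ℝ) hT g x = (g ⟨c, hc⟩ : ℂ) • x := by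
    intro g
    induction g using ContinuousMap.induction_on_of_compact with
    | const r =>
      have : (ContinuousMap.const (spectrum ℝ T) r) = algebraMap ℝ C(spectrum ℝ T, ℝ) r := rfl
      rw [this, AlgHomClass.commutes, Algebra.algebraMap_eq_smul_one, smul_apply,
        one_apply_eq_self]
      simp
    | id =>
      have := cfcHom_id (R := ℝ) hT
      rw [this, hx]
      simp
    | star_id =>
      rw [star_trivial]
      have := cfcHom_id (R := ℝ) hT
      rw [this, hx]
      simp
    | add f g hf hg => rw [map_add, add_apply, hf, hg]; simp [add_smul]
    | mul f g hf hg =>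
      rw [map_mul, mul_apply_eq_comp, hg, map_smul, hf, smul_smul]
      simp [mul_comm]
    | frequently f hf =>
      have hclosed : IsClosed {g : C(spectrum ℝ T, ℝ) |
          cfcHom (R := ℝ) hT g x = (g ⟨c, hc⟩ : ℂ) • x} := by
        refine isClosed_eq ?_ ?_
        · exact ((ContinuousLinearMap.apply ℂ H x).continuous).comp (cfcHom_continuous hT)
        · exact (Complex.continuous_ofReal.comp
            (continuous_eval_const _)).smul continuous_const
      exact hclosed.closure_subset (mem_closure_iff_frequently.2 hf)
  rw [cfc_apply f T hT hf, key]
  rfl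

theorem IsDiag.rpow (h : IsDiag b c T) (hc : ∀ n, 0 ≤ c n) {s : ℝ} (hs : 0 ≤ s) :
    IsDiag b (fun n => c n ^ s) (T ^ s) := by
  intro n
  have h0 := h.nonneg hc
  rw [CFC.rpow_eq_cfc_real h0]
  exact cfc_apply_of_eigenvector (.of_nonneg h0) (h n) (b.orthonormal.ne_zero n)
    (Real.continuous_rpow_const hs).continuousOn

theorem IsDiag.hasTrace_mul_left (hA : IsDiag b c A) (hB : IsDiag g d B) (hc : ∀ n, 0 ≤ c n)
    (hd : ∀ n, 0 ≤ d n) (hs : Summable c) :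
    HasTrace (A * B) ((∑' m, c m * ∑' n, d n * ‖⟪g n, b m⟫_ℂ‖ ^ 2 : ℝ) : ℂ) := by
  have hBsa : ∀ x y, ⟪B x, y⟫_ℂ = ⟪x, B y⟫_ℂ := fun x y => by
    have h : IsSelfAdjoint B := .of_nonneg (hB.nonneg hd)
    rw [← ContinuousLinearMap.adjoint_inner_right, h.adjoint_eq]
  have h := hasTrace_of_hasSum_rankOne (T := A * B) hc (u := b) (v := fun m => B (b m))
    (fun x => by simpa only [hBsa, mul_apply_eq_comp] using hA.hasSum_apply (B x)) ?_
  · convert! h using 1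
    push_cast
    refine tsum_congr fun m => ?_
    obtain ⟨h1, h2⟩ := hB.hasSum_inner (b m)
    rw [hBsa, ← h2, ← h1.tsum_eq]
    push_cast
    rfl
  · refine Summable.of_nonneg_of_le (fun m => mul_nonneg (hc m) (by positivity)) (fun m => ?_)
      (hs.mul_right (1 + ‖B‖ ^ 2))
    have h1 : ‖b m‖ = 1 := b.orthonormal.1 m
    have h2 : ‖B (b m)‖ ≤ ‖B‖ := by simpa [h1] using B.le_opNorm (b m)
    have := hc m
    rw [h1, one_pow]
    gcongr

/-- The image of an orthonormal basis under a unitary operator. -/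
def unitaryBasis (b : HilbertBasis ℕ ℂ H) (U : unitary (H →L[ℂ] H)) : HilbertBasis ℕ ℂ H :=
  .ofRepr ((Unitary.linearIsometryEquiv U).symm.trans b.repr)

theorem unitaryBasis_apply (b : HilbertBasis ℕ ℂ H) (U : unitary (H →L[ℂ] H)) (n : ℕ) :
    unitaryBasis b U n = (U : H →L[ℂ] H) (b n) := by
  rw [← (unitaryBasis b U).repr_symm_single, ← b.repr_symm_single]
  rfl

/-! ### Gaussian states as diagonal operators -/

/-- The eigenvalues of the thermal state. -/
def thermalWeight (β : ℝ) (n : ℕ) : ℝ := (1 - Real.exp (-β)) * Real.exp (-β * n)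

theorem exp_neg_mul_natCast (β : ℝ) (n : ℕ) : Real.exp (-β * n) = Real.exp (-β) ^ n := by
  rw [mul_comm, Real.exp_nat_mul]

theorem thermalWeight_nonneg {β : ℝ} (hβ : 0 < β) (n : ℕ) : 0 ≤ thermalWeight β n :=
  mul_nonneg (by linarith [Real.exp_lt_one_iff.2 (neg_neg_of_pos hβ)]) (Real.exp_pos _).le

theorem hasSum_thermalWeight {β : ℝ} (hβ : 0 < β) : HasSum (thermalWeight β) 1 := by
  have h1 := Real.exp_lt_one_iff.2 (neg_neg_of_pos hβ)
  have h := (hasSum_geometric_of_lt_one (Real.exp_pos (-β)).le h1).mul_left (1 - Real.exp (-β))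
  rw [mul_inv_cancel₀ (by linarith)] at h
  exact h.congr_fun fun n => by rw [thermalWeight, exp_neg_mul_natCast]

theorem isDiag_thermalState (ket : HilbertBasis ℕ ℂ H) {β : ℝ} (hβ : 0 < β) :
    IsDiag ket (thermalWeight β) (thermalState ket β) := by
  have hs : Summable fun n : ℕ => ((thermalWeight β n : ℝ) : ℂ) •
      InnerProductSpace.rankOne ℂ (ket n) (ket n) := by
    refine Summable.of_norm_bounded (hasSum_thermalWeight hβ).summable fun n => ?_
    rw [norm_smul, InnerProductSpace.norm_rankOne, ket.orthonormal.1 n, Complex.norm_real,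
      Real.norm_eq_abs, abs_of_nonneg (thermalWeight_nonneg hβ n)]
    simp
  intro k
  have h := (hs.hasSum.mapL (ContinuousLinearMap.apply ℂ H (ket k))).tsum_eq
  change _ = thermalState ket β (ket k) at h
  rw [← h, tsum_eq_single k]
  · simp [InnerProductSpace.rankOne_apply, inner_self_eq_norm_sq_to_K, ket.orthonormal.1 k]
  · intro n hn
    simp [InnerProductSpace.rankOne_apply, ket.orthonormal.2 hn]

/-- The eigenbasis `D(ξ)† S(r, θ)† |n⟩` of a Gaussian state. -/
def gaussianBasis (ket : HilbertBasis ℕ ℂ H) (ξ : Fin 2 → ℝ) (r θ : ℝ) : HilbertBasis ℕ ℂ H :=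
  unitaryBasis ket ⟨star (displaceOp ket ξ) * star (squeezeOp ket r θ),
    mul_mem (Unitary.star_mem (opExp_mem_unitary ket _))
      (Unitary.star_mem (opExp_mem_unitary ket _))⟩

theorem gaussianBasis_apply (ket : HilbertBasis ℕ ℂ H) (ξ : Fin 2 → ℝ) (r θ : ℝ) (n : ℕ) :
    gaussianBasis ket ξ r θ n = star (displaceOp ket ξ) (star (squeezeOp ket r θ) (ket n)) :=
  unitaryBasis_apply _ _ _

theorem isDiag_gaussianState (ket : HilbertBasis ℕ ℂ H) {β : ℝ} (hβ : 0 < β) (ξ : Fin 2 → ℝ)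
    (r θ : ℝ) :
    IsDiag (gaussianBasis ket ξ r θ) (thermalWeight β) (gaussianState ket β ξ r θ) := by
  intro n
  have hD : displaceOp ket ξ * star (displaceOp ket ξ) = 1 := (opExp_mem_unitary ket _).2
  have hS : squeezeOp ket r θ * star (squeezeOp ket r θ) = 1 := (opExp_mem_unitary ket _).2
  have h : gaussianState ket β ξ r θ * (star (displaceOp ket ξ) * star (squeezeOp ket r θ)) =
      star (displaceOp ket ξ) * star (squeezeOp ket r θ) * thermalState ket β := by
    rw [gaussianState, mul_assoc _ (displaceOp ket ξ), ← mul_assoc (displaceOp ket ξ), hD, one_mul,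
      mul_assoc, hS, mul_one]
  have h' := congrArg (fun T : H →L[ℂ] H => T (ket n)) h
  simp only [mul_apply_eq_comp, isDiag_thermalState ket hβ n, map_smul] at h'
  rw [gaussianBasis_apply, h']

theorem inner_gaussianBasis (ket : HilbertBasis ℕ ℂ H) (ξ : Fin 2 → ℝ) (r₀ θ₀ r₁ θ₁ : ℝ)
    (m n : ℕ) : ⟪gaussianBasis ket ξ r₀ θ₀ m, gaussianBasis ket ξ r₁ θ₁ n⟫_ℂ =
      ⟪star (squeezeOp ket r₀ θ₀) (ket m), star (squeezeOp ket r₁ θ₁) (ket n)⟫_ℂ := by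
  rw [gaussianBasis_apply, gaussianBasis_apply]
  exact ContinuousLinearMap.inner_map_map_of_mem_unitary
    (Unitary.star_mem (opExp_mem_unitary ket _)) _ _

end Diagonal

/-! ### Matrix elements of the relative squeezing -/

section MatrixElements

variable {H : Type*} [NormedAddCommGroup H] [InnerProductSpace ℂ H]

/-- If `a x = x'` and `a† y = y'` in the weak sense, then `⟪y, a x⟫ = ⟪a† y, x⟫`. -/
theorem inner_weak_ann (ket : HilbertBasis ℕ ℂ H) {x x' y y' : H}
    (hx : ∀ e, ⟪incl ket e, x'⟫_ℂ = ⟪incl ket (cre e), x⟫_ℂ)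
    (hy : ∀ e, ⟪incl ket e, y'⟫_ℂ = ⟪incl ket (ann e), y⟫_ℂ) : ⟪y, x'⟫_ℂ = ⟪y', x⟫_ℂ := by
  have hx' : ∀ k, ⟪ket k, x'⟫_ℂ = (√((k : ℝ) + 1) : ℝ) * ⟪ket (k + 1), x⟫_ℂ := fun k => by
    have h := hx (Finsupp.single k 1)
    rw [cre_single, incl_single, incl_single, one_smul, inner_smul_left, one_mul,
      Complex.conj_ofReal] at h
    exact h
  have hy' : ∀ k, ⟪y', ket k⟫_ℂ = (√(k : ℝ) : ℝ) * ⟪y, ket (k - 1)⟫_ℂ := fun k => by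
    have h := hy (Finsupp.single k 1)
    rw [ann_single, incl_single, incl_single, one_smul, inner_smul_left, one_mul,
      Complex.conj_ofReal] at h
    rw [← inner_conj_symm, h, map_mul, inner_conj_symm, Complex.conj_ofReal]
  have h1 := ket.hasSum_inner_mul_inner y x'
  have h2 := ket.hasSum_inner_mul_inner y' x
  rw [← hasSum_nat_add_iff' 1] at h2
  simp only [Finset.sum_range_one, hy', Nat.cast_zero, Real.sqrt_zero, Complex.ofReal_zero,
    zero_mul, sub_zero] at h2
  refine h1.unique (h2.congr_fun fun k => ?_)
  rw [hx', Nat.add_sub_cancel]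
  push_cast
  ring

variable [CompleteSpace H]

/-- The matrix element `⟨m| S₀ S₁† |n⟩` of the relative squeezing. -/
def relElem (ket : HilbertBasis ℕ ℂ H) (r₀ θ₀ r₁ θ₁ : ℝ) (m n : ℕ) : ℂ :=
  ⟪star (squeezeOp ket r₀ θ₀) (ket m), star (squeezeOp ket r₁ θ₁) (ket n)⟫_ℂ

/-- The coefficient `e^{2iθ} sinh r` of `a†` in `S a S†`. -/
def sqzCoeff (r θ : ℝ) : ℂ := Complex.exp (2 * θ * Complex.I) * Real.sinh r

theorem conj_sqzCoeff (r θ : ℝ) : (starRingEnd ℂ) (sqzCoeff r θ) =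
    Complex.exp (-(2 * θ * Complex.I)) * Real.sinh r := by
  rw [sqzCoeff, map_mul, conj_exp_two_mul_I, Complex.conj_ofReal]

theorem normSq_sqzCoeff (r θ : ℝ) : Complex.normSq (sqzCoeff r θ) = Real.sinh r ^ 2 := by
  rw [Complex.normSq_eq_norm_sq, sqzCoeff, norm_mul, norm_exp_two_mul_I, one_mul,
    Complex.norm_real, Real.norm_eq_abs, sq_abs]

/-- `S† (cosh r a + e^{2iθ} sinh r a†) |n⟩`. -/
def lowered (ket : HilbertBasis ℕ ℂ H) (r θ : ℝ) (n : ℕ) : H :=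
  star (squeezeOp ket r θ) (((Real.cosh r * √n : ℝ) : ℂ) • ket (n - 1) +
    (sqzCoeff r θ * (√((n : ℝ) + 1) : ℝ)) • ket (n + 1))

/-- `S† (cosh r a† + e^{-2iθ} sinh r a) |n⟩`. -/
def raised (ket : HilbertBasis ℕ ℂ H) (r θ : ℝ) (n : ℕ) : H :=
  star (squeezeOp ket r θ) (((Real.cosh r * √((n : ℝ) + 1) : ℝ) : ℂ) • ket (n + 1) +
    ((starRingEnd ℂ) (sqzCoeff r θ) * (√n : ℝ)) • ket (n - 1))

theorem inner_lowered (ket : HilbertBasis ℕ ℂ H) (r θ : ℝ) (n : ℕ) (e : FiniteVec) :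
    ⟪incl ket e, lowered ket r θ n⟫_ℂ =
      ⟪incl ket (cre e), star (squeezeOp ket r θ) (ket n)⟫_ℂ := by
  have h := inner_cre_star_squeezeOp (ket := ket) r θ e (Finsupp.single n 1)
  rw [incl_single, one_smul, ann_single, cre_single, incl_single, incl_single] at h
  rw [h, lowered, sqzCoeff]
  simp only [map_add, map_smul, inner_add_right, inner_smul_right]
  push_cast
  ring

theorem inner_raised (ket : HilbertBasis ℕ ℂ H) (r θ : ℝ) (n : ℕ) (e : FiniteVec) :
    ⟪incl ket e, raised ket r θ n⟫_ℂ =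
      ⟪incl ket (ann e), star (squeezeOp ket r θ) (ket n)⟫_ℂ := by
  have h := inner_ann_star_squeezeOp (ket := ket) r θ e (Finsupp.single n 1)
  rw [incl_single, one_smul, ann_single, cre_single, incl_single, incl_single] at h
  rw [h, raised, conj_sqzCoeff]
  simp only [map_add, map_smul, inner_add_right, inner_smul_right]
  push_cast
  ring

variable (ket : HilbertBasis ℕ ℂ H) (r₀ θ₀ r₁ θ₁ : ℝ)

theorem relElem_rec_ann (m n : ℕ) :
    (Real.cosh r₁ : ℂ) * ((√n : ℝ) * relElem ket r₀ θ₀ r₁ θ₁ m (n - 1)) +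
      sqzCoeff r₁ θ₁ * ((√((n : ℝ) + 1) : ℝ) * relElem ket r₀ θ₀ r₁ θ₁ m (n + 1)) =
    (Real.cosh r₀ : ℂ) * ((√((m : ℝ) + 1) : ℝ) * relElem ket r₀ θ₀ r₁ θ₁ (m + 1) n) +
      sqzCoeff r₀ θ₀ * ((√m : ℝ) * relElem ket r₀ θ₀ r₁ θ₁ (m - 1) n) := by
  have h := inner_weak_ann ket (inner_lowered ket r₁ θ₁ n) (inner_raised ket r₀ θ₀ m)
  simp only [lowered, raised, map_add, map_smul, inner_add_right, inner_smul_right, inner_add_left,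
    inner_smul_left, map_mul, Complex.conj_ofReal, Complex.conj_conj] at h
  simp only [relElem]
  push_cast at h ⊢
  linear_combination h

theorem relElem_rec_cre (m n : ℕ) :
    (Real.cosh r₁ : ℂ) * ((√((n : ℝ) + 1) : ℝ) * relElem ket r₀ θ₀ r₁ θ₁ m (n + 1)) +
      (starRingEnd ℂ) (sqzCoeff r₁ θ₁) * ((√n : ℝ) * relElem ket r₀ θ₀ r₁ θ₁ m (n - 1)) =
    (Real.cosh r₀ : ℂ) * ((√m : ℝ) * relElem ket r₀ θ₀ r₁ θ₁ (m - 1) n) +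
      (starRingEnd ℂ) (sqzCoeff r₀ θ₀) *
        ((√((m : ℝ) + 1) : ℝ) * relElem ket r₀ θ₀ r₁ θ₁ (m + 1) n) := by
  have h := inner_weak_ann ket (inner_lowered ket r₀ θ₀ m) (inner_raised ket r₁ θ₁ n)
  rw [← inner_conj_symm, ← inner_conj_symm (raised ket r₁ θ₁ n)] at h
  replace h := (starRingEnd ℂ).injective h
  simp only [lowered, raised, map_add, map_smul, inner_add_right, inner_smul_right, inner_add_left,
    inner_smul_left, map_mul, Complex.conj_ofReal] at h
  simp only [relElem]
  push_cast at h ⊢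
  linear_combination -h

/-- The transition probabilities `|⟨m| S₀ S₁† |n⟩|²`. -/
def relProb (m n : ℕ) : ℝ := ‖relElem ket r₀ θ₀ r₁ θ₁ m n‖ ^ 2

theorem norm_star_squeezeOp (r θ : ℝ) (x : H) : ‖star (squeezeOp ket r θ) x‖ = ‖x‖ :=
  ContinuousLinearMap.norm_map_of_mem_unitary (Unitary.star_mem (opExp_mem_unitary ket _)) x

theorem abs_relProb_le (m n : ℕ) : |relProb ket r₀ θ₀ r₁ θ₁ m n| ≤ 1 := by
  rw [relProb, abs_of_nonneg (by positivity)]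
  refine pow_le_one₀ (norm_nonneg _) ((norm_inner_le_norm _ _).trans ?_)
  rw [norm_star_squeezeOp, norm_star_squeezeOp, ket.orthonormal.1, ket.orthonormal.1, one_mul]

theorem normSq_sqrt_mul {a : ℝ} (ha : 0 ≤ a) (z : ℂ) :
    Complex.normSq ((√a : ℝ) * z) = a * ‖z‖ ^ 2 := by
  rw [Complex.normSq_mul, Complex.normSq_ofReal, Real.mul_self_sqrt ha, Complex.normSq_eq_norm_sq]

theorem normSq_sub_normSq (c : ℝ) (ν A B : ℂ) :
    Complex.normSq (c * A + ν * B) - Complex.normSq (c * B + (starRingEnd ℂ) ν * A) =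
      (c ^ 2 - Complex.normSq ν) * (Complex.normSq A - Complex.normSq B) := by
  simp only [Complex.normSq_apply, Complex.add_re, Complex.add_im, Complex.mul_re, Complex.mul_im,
    Complex.ofReal_re, Complex.ofReal_im, Complex.conj_re, Complex.conj_im]
  ring

/-- The interference terms cancel between the two recurrences of the matrix elements, which leaves
a recurrence for the transition probabilities alone. -/
theorem relProb_rec (m n : ℕ) :
    n * relProb ket r₀ θ₀ r₁ θ₁ m (n - 1) - (n + 1) * relProb ket r₀ θ₀ r₁ θ₁ m (n + 1) =
      (m + 1) * relProb ket r₀ θ₀ r₁ θ₁ (m + 1) n - m * relProb ket r₀ θ₀ r₁ θ₁ (m - 1) n := by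
  have h1 := congrArg Complex.normSq (relElem_rec_ann ket r₀ θ₀ r₁ θ₁ m n)
  have h2 := congrArg Complex.normSq (relElem_rec_cre ket r₀ θ₀ r₁ θ₁ m n)
  have h3 := congrArg₂ (· - ·) h1 h2
  simp only [normSq_sub_normSq, normSq_sqzCoeff, Real.cosh_sq, add_sub_cancel_left, one_mul] at h3
  rw [normSq_sqrt_mul (by positivity), normSq_sqrt_mul (by positivity),
    normSq_sqrt_mul (by positivity), normSq_sqrt_mul (by positivity)] at h3
  exact h3

/-- `cosh² R` for the relative squeezing parameter `R`: the squared modulus of the coefficient of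
`a` in `(S₀ S₁†) a (S₀ S₁†)†`. -/
def coshSqR : ℝ :=
  Complex.normSq (Real.cosh r₀ * Real.cosh r₁ - (starRingEnd ℂ) (sqzCoeff r₀ θ₀) * sqzCoeff r₁ θ₁)

theorem coshSqR_sub_one : coshSqR r₀ θ₀ r₁ θ₁ - 1 = Complex.normSq
    ((starRingEnd ℂ) (sqzCoeff r₀ θ₀) * Real.cosh r₁ -
      Real.cosh r₀ * (starRingEnd ℂ) (sqzCoeff r₁ θ₁)) := by
  have h0 := normSq_sqzCoeff r₀ θ₀
  have h1 := normSq_sqzCoeff r₁ θ₁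
  have e0 := Real.cosh_sq r₀
  have e1 := Real.cosh_sq r₁
  rw [← h0] at e0
  rw [← h1] at e1
  rw [coshSqR]
  simp only [Complex.normSq_apply, Complex.sub_re, Complex.sub_im, Complex.mul_re, Complex.mul_im,
    Complex.ofReal_re, Complex.ofReal_im, Complex.conj_re, Complex.conj_im] at e0 e1 ⊢
  linear_combination e0 * (Real.cosh r₁ ^ 2 - (sqzCoeff r₁ θ₁).re ^ 2 - (sqzCoeff r₁ θ₁).im ^ 2)
    + e1

theorem one_le_coshSqR : 1 ≤ coshSqR r₀ θ₀ r₁ θ₁ := by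
  have h := coshSqR_sub_one r₀ θ₀ r₁ θ₁
  have := Complex.normSq_nonneg ((starRingEnd ℂ) (sqzCoeff r₀ θ₀) * Real.cosh r₁ -
      Real.cosh r₀ * (starRingEnd ℂ) (sqzCoeff r₁ θ₁))
  linarith

/-- The first row of transition probabilities: `m = 0` lets one eliminate the row `m = 1`. -/
theorem relProb_row (n : ℕ) :
    (n + 1) * relProb ket r₀ θ₀ r₁ θ₁ 0 (n + 1) =
      (coshSqR r₀ θ₀ r₁ θ₁ - 1) / coshSqR r₀ θ₀ r₁ θ₁ *
        (n * relProb ket r₀ θ₀ r₁ θ₁ 0 (n - 1)) := by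
  have h1 := relElem_rec_ann ket r₀ θ₀ r₁ θ₁ 0 n
  have h2 := relElem_rec_cre ket r₀ θ₀ r₁ θ₁ 0 n
  have hP := one_le_coshSqR r₀ θ₀ r₁ θ₁
  simp only [Nat.cast_zero, Real.sqrt_zero, Complex.ofReal_zero, zero_mul, mul_zero, add_zero,
    zero_add] at h1 h2
  have h3 : (Real.cosh r₀ * Real.cosh r₁ - (starRingEnd ℂ) (sqzCoeff r₀ θ₀) * sqzCoeff r₁ θ₁) *
      ((√((n : ℝ) + 1) : ℝ) * relElem ket r₀ θ₀ r₁ θ₁ 0 (n + 1)) =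
      ((starRingEnd ℂ) (sqzCoeff r₀ θ₀) * Real.cosh r₁ -
      Real.cosh r₀ * (starRingEnd ℂ) (sqzCoeff r₁ θ₁)) *
      ((√(n : ℝ) : ℝ) * relElem ket r₀ θ₀ r₁ θ₁ 0 (n - 1)) := by
    linear_combination (Real.cosh r₀ : ℂ) * h2 - (starRingEnd ℂ) (sqzCoeff r₀ θ₀) * h1
  have h4 := congrArg Complex.normSq h3
  rw [Complex.normSq_mul, normSq_sqrt_mul (by positivity), Complex.normSq_mul,
    normSq_sqrt_mul (by positivity), ← coshSqR, ← coshSqR_sub_one] at h4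
  rw [div_mul_eq_mul_div, eq_div_iff (by positivity), mul_comm]
  exact h4

theorem hasSum_relProb (m : ℕ) : HasSum (relProb ket r₀ θ₀ r₁ θ₁ m) 1 := by
  have h := tsum_norm_inner_sq
    (unitaryBasis ket ⟨star (squeezeOp ket r₁ θ₁), Unitary.star_mem (opExp_mem_unitary ket _)⟩)
    (x := star (squeezeOp ket r₀ θ₀) (ket m))
    (by rw [norm_star_squeezeOp, ket.orthonormal.1])
  refine h.congr_fun fun n => ?_
  rw [relProb, relElem, norm_inner_symm, unitaryBasis_apply]

end MatrixElements

/-! ### The traces `Q_s` -/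

section Chernoff

variable {H : Type*} [NormedAddCommGroup H] [InnerProductSpace ℂ H] [CompleteSpace H]

theorem thermalWeight_rpow {β : ℝ} (hβ : 0 < β) (s : ℝ) (n : ℕ) :
    thermalWeight β n ^ s = (1 - Real.exp (-β)) ^ s * Real.exp (-β * s) ^ n := by
  rw [thermalWeight, Real.mul_rpow (by linarith [Real.exp_lt_one_iff.2 (neg_neg_of_pos hβ)])
    (Real.exp_pos _).le, ← Real.exp_mul, ← Real.exp_nat_mul]
  congr 2
  ring

theorem chernoffQ_eq_of_hasTrace {ket : HilbertBasis ℕ ℂ H} {ρ₀ ρ₁ : H →L[ℂ] H} {s q : ℝ}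
    (h : HasTrace (ρ₀ ^ s * ρ₁ ^ (1 - s)) (q : ℂ)) : chernoffQ ket ρ₀ ρ₁ s = q := by
  rw [chernoffQ, h.trace_eq ket, Complex.ofReal_re]

/-- `sinh (β (s - 1/2)) / sinh (β / 2)`, written as `(y - x) / (1 - x y)` with `x = e^{-β s}` and
`y = e^{-β (1 - s)}`, the form in which it comes out of the generating function. -/
def skewness (β s : ℝ) : ℝ :=
  (Real.exp (-β * (1 - s)) - Real.exp (-β * s)) / (1 - Real.exp (-β))

variable (ket : HilbertBasis ℕ ℂ H) {β : ℝ}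

theorem exists_hasTrace_gaussian_of_mem_Ioo (hβ : 0 < β) (ξ : Fin 2 → ℝ)
    (r₀ θ₀ r₁ θ₁ : ℝ) {s : ℝ} (hs : s ∈ Set.Ioo (0 : ℝ) 1) :
    ∃ q : ℝ, HasTrace (gaussianState ket β ξ r₀ θ₀ ^ s * gaussianState ket β ξ r₁ θ₁ ^ (1 - s))
      (q : ℂ) ∧ 0 ≤ q ∧
      q ^ 2 * (coshSqR r₀ θ₀ r₁ θ₁ - (coshSqR r₀ θ₀ r₁ θ₁ - 1) * skewness β s ^ 2) = 1 := by
  have hw := thermalWeight_nonneg hβ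
  have hA := (isDiag_gaussianState ket hβ ξ r₀ θ₀).rpow hw hs.1.le
  have hB := (isDiag_gaussianState ket hβ ξ r₁ θ₁).rpow hw (sub_nonneg.2 hs.2.le)
  set P := coshSqR r₀ θ₀ r₁ θ₁ with hP
  have hP1 : 1 ≤ P := one_le_coshSqR r₀ θ₀ r₁ θ₁
  have hz : 0 < 1 - Real.exp (-β) := by
    linarith [Real.exp_lt_one_iff.2 (neg_neg_of_pos hβ)]
  set x := Real.exp (-β * s) with hx
  set y := Real.exp (-β * (1 - s)) with hy
  have hx1 : |x| < 1 := by
    rw [abs_of_pos (Real.exp_pos _), Real.exp_lt_one_iff]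
    nlinarith [mul_pos hβ hs.1]
  have hy1 : |y| < 1 := by
    rw [abs_of_pos (Real.exp_pos _), Real.exp_lt_one_iff]
    nlinarith [mul_pos hβ (sub_pos.2 hs.2)]
  have hxy : x * y = Real.exp (-β) := by
    rw [hx, hy, ← Real.exp_add]; congr 1; ring
  have hsum : Summable fun m => thermalWeight β m ^ s := by
    have : Summable fun m : ℕ => x ^ m :=
      summable_geometric_of_lt_one (Real.exp_pos _).le ((le_abs_self x).trans_lt hx1)
    exact (this.mul_left ((1 - Real.exp (-β)) ^ s)).congr fun m =>
      (thermalWeight_rpow hβ s m).symm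
  have htr := hA.hasTrace_mul_left hB (fun n => Real.rpow_nonneg (hw n) _)
    (fun n => Real.rpow_nonneg (hw n) _) hsum
  set p := relProb ket r₀ θ₀ r₁ θ₁ with hp
  have hpb : ∀ m n, |p m n| ≤ 1 := abs_relProb_le ket r₀ θ₀ r₁ θ₁
  have hval : ∑' m, thermalWeight β m ^ s * ∑' n, thermalWeight β n ^ (1 - s) *
      ‖⟪gaussianBasis ket ξ r₁ θ₁ n, gaussianBasis ket ξ r₀ θ₀ m⟫_ℂ‖ ^ 2 =
      (1 - Real.exp (-β)) * genFun p x y := by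
    have h1 : (1 - Real.exp (-β)) ^ s * (1 - Real.exp (-β)) ^ (1 - s) = 1 - Real.exp (-β) := by
      rw [← Real.rpow_add hz, add_sub_cancel, Real.rpow_one]
    rw [genFun, (summable_genFun hpb hx1 hy1).tsum_prod, ← h1, ← tsum_mul_left]
    refine tsum_congr fun m => ?_
    rw [← tsum_mul_left, ← tsum_mul_left]
    refine tsum_congr fun n => ?_
    rw [norm_inner_symm, inner_gaussianBasis, thermalWeight_rpow hβ, thermalWeight_rpow hβ, hp,
      relProb, relElem]
    ring
  rw [hval] at htr
  refine ⟨_, htr, ?_, ?_⟩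
  · refine mul_nonneg hz.le (tsum_nonneg fun k => ?_)
    have : 0 ≤ p k.1 k.2 := by rw [hp, relProb]; positivity
    have := Real.exp_pos (-β * s)
    have := Real.exp_pos (-β * (1 - s))
    positivity
  · have hgf := genFun_sq hpb (relProb_rec ket r₀ θ₀ r₁ θ₁) (relProb_row ket r₀ θ₀ r₁ θ₁)
      (hasSum_relProb ket r₀ θ₀ r₁ θ₁ 0) hx1 hy1
    rw [hxy, ← hP] at hgf
    have hP0 : P ≠ 0 := by positivity
    have hgf' : genFun p x y ^ 2 * (P * (1 - Real.exp (-β)) ^ 2 - (P - 1) * (y - x) ^ 2) = 1 := by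
      field_simp at hgf
      linear_combination hgf
    rw [skewness, ← hx, ← hy]
    refine Eq.trans ?_ hgf'
    field_simp

theorem exists_hasTrace_gaussian (hβ : 0 < β) (ξ : Fin 2 → ℝ)
    (r₀ θ₀ r₁ θ₁ : ℝ) {s : ℝ} (hs : s ∈ Set.Icc (0 : ℝ) 1) :
    ∃ q : ℝ, HasTrace (gaussianState ket β ξ r₀ θ₀ ^ s * gaussianState ket β ξ r₁ θ₁ ^ (1 - s))
      (q : ℂ) ∧ 0 ≤ q ∧
      q ^ 2 * (coshSqR r₀ θ₀ r₁ θ₁ - (coshSqR r₀ θ₀ r₁ θ₁ - 1) * skewness β s ^ 2) = 1 := by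
  have hw := thermalWeight_nonneg hβ
  have hz : 1 - Real.exp (-β) ≠ 0 := by
    linarith [Real.exp_lt_one_iff.2 (neg_neg_of_pos hβ)]
  have hA := (isDiag_gaussianState ket hβ ξ r₀ θ₀).rpow hw hs.1
  have hB := (isDiag_gaussianState ket hβ ξ r₁ θ₁).rpow hw (sub_nonneg.2 hs.2)
  rcases hs.1.eq_or_lt with h | h0
  · subst h
    have h1 : (fun n => thermalWeight β n ^ ((1 : ℝ) - 0)) = thermalWeight β := by simp
    have h0 : (fun n => thermalWeight β n ^ (0 : ℝ)) = fun _ => 1 := by simp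
    rw [h0] at hA
    rw [h1] at hB
    have htr := hA.hasTrace_mul_right hB hw (hasSum_thermalWeight hβ).summable
    refine ⟨1, ?_, zero_le_one, ?_⟩
    · convert! htr using 2
      refine (hasSum_thermalWeight hβ).tsum_eq.symm.trans (tsum_congr fun n => ?_)
      simp only [one_mul]
      rw [(tsum_norm_inner_sq _ ((gaussianBasis ket ξ r₁ θ₁).orthonormal.1 n)).tsum_eq, mul_one]
    · have : skewness β 0 = -1 := by
        rw [skewness]; simp; field_simp; ring
      rw [this]; ring
  rcases hs.2.eq_or_lt with h | h1
  · subst h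
    have h1 : (fun n => thermalWeight β n ^ (1 : ℝ)) = thermalWeight β := by simp
    have h0 : (fun n => thermalWeight β n ^ ((1 : ℝ) - 1)) = fun _ => 1 := by simp
    rw [h1] at hA
    rw [h0] at hB
    have htr := hA.hasTrace_mul_left hB hw (fun _ => zero_le_one)
      (hasSum_thermalWeight hβ).summable
    refine ⟨1, ?_, zero_le_one, ?_⟩
    · convert! htr using 2
      refine (hasSum_thermalWeight hβ).tsum_eq.symm.trans (tsum_congr fun n => ?_)
      simp only [one_mul]
      rw [(tsum_norm_inner_sq _ ((gaussianBasis ket ξ r₀ θ₀).orthonormal.1 n)).tsum_eq, mul_one]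
    · have : skewness β 1 = 1 := by
        rw [skewness]; simpa using div_self hz
      rw [this]; ring
  exact exists_hasTrace_gaussian_of_mem_Ioo ket hβ ξ r₀ θ₀ r₁ θ₁ ⟨h0, h1⟩

end Chernoff

/-! ### The relative squeezing parameter -/

section PhaseSpace

theorem squeezeMat_eq (r θ : ℝ) : squeezeMat r θ =
    !![Real.cosh r + Real.sinh r * Real.cos (2 * θ), -(Real.sinh r * Real.sin (2 * θ));
      -(Real.sinh r * Real.sin (2 * θ)), Real.cosh r - Real.sinh r * Real.cos (2 * θ)] := by
  have h := Real.sin_sq_add_cos_sq θ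
  rw [Real.cos_two_mul, Real.sin_two_mul, Real.cosh_eq, Real.sinh_eq, squeezeMat, rotMat, diagMat]
  ext i j
  fin_cases i <;> fin_cases j <;> simp [Matrix.mul_apply, Fin.sum_univ_two, Matrix.transpose_apply]
  · linear_combination Real.exp (-r) * h
  · ring
  · ring
  · linear_combination Real.exp r * h

theorem squeezeMat_transpose (r θ : ℝ) : (squeezeMat r θ)ᵀ = squeezeMat r θ := by
  rw [squeezeMat_eq]
  ext i j
  fin_cases i <;> fin_cases j <;> rfl

theorem squeezeMat_mul_squeezeMat (r s θ : ℝ) :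
    squeezeMat r θ * squeezeMat s θ = squeezeMat (r + s) θ := by
  have h := Real.sin_sq_add_cos_sq (2 * θ)
  simp only [squeezeMat_eq, Real.cosh_add, Real.sinh_add]
  ext i j
  fin_cases i <;> fin_cases j <;> simp [Matrix.mul_apply, Fin.sum_univ_two]
  · linear_combination Real.sinh r * Real.sinh s * h
  · ring
  · ring
  · linear_combination Real.sinh r * Real.sinh s * h

theorem squeezeMat_inv (r θ : ℝ) : (squeezeMat r θ)⁻¹ = squeezeMat (-r) θ := by
  refine Matrix.inv_eq_right_inv ?_
  rw [squeezeMat_mul_squeezeMat, add_neg_cancel, squeezeMat_eq]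
  ext i j
  fin_cases i <;> fin_cases j <;> simp

theorem squeezeMat_det (r θ : ℝ) : (squeezeMat r θ).det = 1 := by
  rw [squeezeMat_eq, Matrix.det_fin_two_of]
  linear_combination Real.cosh_sq r - Real.sinh r ^ 2 * Real.sin_sq_add_cos_sq (2 * θ)

theorem sqzCoeff_eq (r θ : ℝ) : sqzCoeff r θ =
    ⟨Real.cos (2 * θ) * Real.sinh r, Real.sin (2 * θ) * Real.sinh r⟩ := by
  apply Complex.ext <;> simp [sqzCoeff, Complex.exp_re, Complex.exp_im] <;> exact Or.inl rfl

theorem coshSqR_eq (r₀ θ₀ r₁ θ₁ : ℝ) : coshSqR r₀ θ₀ r₁ θ₁ =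
    Real.cosh (r₀ - r₁) ^ 2 + Real.sin (θ₀ - θ₁) ^ 2 * Real.sinh (2 * r₀) * Real.sinh (2 * r₁) := by
  have h0 := sqzCoeff_eq r₀ θ₀
  have h1 := sqzCoeff_eq r₁ θ₁
  have hc : Real.cos (2 * θ₀) * Real.cos (2 * θ₁) + Real.sin (2 * θ₀) * Real.sin (2 * θ₁) =
      1 - 2 * Real.sin (θ₀ - θ₁) ^ 2 := by
    rw [← Real.cos_sub, ← mul_sub, Real.cos_two_mul, Real.cos_sq']
    ring
  have e0 := Real.sin_sq_add_cos_sq (2 * θ₀)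
  have e1 := Real.sin_sq_add_cos_sq (2 * θ₁)
  rw [coshSqR, h0, h1]
  simp only [Complex.normSq_apply, Complex.sub_re, Complex.sub_im, Complex.mul_re, Complex.mul_im,
    Complex.ofReal_re, Complex.ofReal_im, Complex.conj_re, Complex.conj_im, Real.cosh_sub,
    Real.sinh_two_mul]
  linear_combination (-2 * Real.cosh r₀ * Real.cosh r₁ * Real.sinh r₀ * Real.sinh r₁) * hc +
    Real.sinh r₀ ^ 2 * Real.sinh r₁ ^ 2 *
      ((Real.sin (2 * θ₁) ^ 2 + Real.cos (2 * θ₁) ^ 2) * e0 + e1)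

theorem two_mul_coshSqR_sub_one (r₀ θ₀ r₁ θ₁ : ℝ) : 2 * coshSqR r₀ θ₀ r₁ θ₁ - 1 =
    Real.cos (θ₀ - θ₁) ^ 2 * Real.cosh (2 * (r₀ - r₁))
      + Real.sin (θ₀ - θ₁) ^ 2 * Real.cosh (2 * (r₀ + r₁)) := by
  have h : ∀ x : ℝ, Real.cosh (2 * x) = 2 * Real.cosh x ^ 2 - 1 := fun x => by
    rw [Real.cosh_two_mul, Real.sinh_sq]; ring
  rw [coshSqR_eq, h, h, Real.cosh_sub, Real.cosh_add, Real.sinh_two_mul, Real.sinh_two_mul]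
  have e := Real.sin_sq_add_cos_sq (θ₀ - θ₁)
  linear_combination (1 - 2 * (Real.cosh r₀ * Real.cosh r₁ - Real.sinh r₀ * Real.sinh r₁) ^ 2) * e

theorem isRelativeSqueezing_iff (r₀ θ₀ r₁ θ₁ R Φ : ℝ) : IsRelativeSqueezing r₀ θ₀ r₁ θ₁ R Φ ↔
    squeezeMat (-r₀) θ₀ * squeezeMat (2 * r₁) θ₁ * squeezeMat (-r₀) θ₀ = squeezeMat (2 * R) Φ := by
  rw [IsRelativeSqueezing, squeezeMat_inv, Matrix.transpose_mul, squeezeMat_transpose,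
    squeezeMat_transpose, squeezeMat_transpose, squeezeMat_mul_squeezeMat, ← two_mul,
    Matrix.mul_assoc, ← Matrix.mul_assoc (squeezeMat r₁ θ₁), squeezeMat_mul_squeezeMat, ← two_mul,
    ← Matrix.mul_assoc]

/-- The trace of the relative covariance matrix. -/
theorem IsRelativeSqueezing.cosh_two_mul {r₀ θ₀ r₁ θ₁ R Φ : ℝ}
    (h : IsRelativeSqueezing r₀ θ₀ r₁ θ₁ R Φ) :
    Real.cosh (2 * R) = 2 * coshSqR r₀ θ₀ r₁ θ₁ - 1 := by
  rw [isRelativeSqueezing_iff] at h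
  have ht := congrArg Matrix.trace h
  rw [Matrix.trace_mul_comm, ← Matrix.mul_assoc, squeezeMat_mul_squeezeMat, squeezeMat_eq,
    squeezeMat_eq, squeezeMat_eq] at ht
  simp only [Matrix.trace_fin_two, Matrix.mul_apply, Fin.sum_univ_two, Matrix.of_apply,
    Matrix.cons_val', Matrix.cons_val_zero, Matrix.cons_val_one, Matrix.cons_val_fin_one] at ht
  have hr : -r₀ + -r₀ = -(2 * r₀) := by ring
  rw [hr, Real.cosh_neg, Real.sinh_neg] at ht
  have hc : Real.cos (2 * θ₀) * Real.cos (2 * θ₁) + Real.sin (2 * θ₀) * Real.sin (2 * θ₁) =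
      1 - 2 * Real.sin (θ₀ - θ₁) ^ 2 := by
    rw [← Real.cos_sub, ← mul_sub, Real.cos_two_mul, Real.cos_sq']
    ring
  have hP : 2 * Real.cosh (r₀ - r₁) ^ 2 - 1 = Real.cosh (2 * r₀) * Real.cosh (2 * r₁) -
      Real.sinh (2 * r₀) * Real.sinh (2 * r₁) := by
    rw [← Real.cosh_sub, ← mul_sub, Real.cosh_two_mul, Real.sinh_sq]; ring
  rw [coshSqR_eq]
  linear_combination (-1 / 2) * ht - hP - Real.sinh (2 * r₀) * Real.sinh (2 * r₁) * hc

/-- A symmetric positive `2 × 2` matrix `N Nᵗ` of determinant one is a squeezing matrix. -/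
theorem exists_isRelativeSqueezing (r₀ θ₀ r₁ θ₁ : ℝ) :
    ∃ R Φ : ℝ, 0 ≤ R ∧ IsRelativeSqueezing r₀ θ₀ r₁ θ₁ R Φ := by
  set N := (squeezeMat r₀ θ₀)⁻¹ * squeezeMat r₁ θ₁ with hN
  have hdet : N 0 0 * N 1 1 - N 0 1 * N 1 0 = 1 := by
    rw [← Matrix.det_fin_two, hN, squeezeMat_inv, Matrix.det_mul, squeezeMat_det, squeezeMat_det,
      one_mul]
  set A := N 0 0 ^ 2 + N 0 1 ^ 2 with hA
  set B := N 0 0 * N 1 0 + N 0 1 * N 1 1 with hB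
  set C := N 1 0 ^ 2 + N 1 1 ^ 2 with hC
  have hABC : A * C - B ^ 2 = 1 := by
    rw [hA, hB, hC]
    linear_combination (N 0 0 * N 1 1 - N 0 1 * N 1 0 + 1) * hdet
  have hAC : 2 ≤ A + C := by
    rw [hA, hC]
    nlinarith [sq_nonneg (N 0 0 - N 1 1), sq_nonneg (N 0 1 + N 1 0)]
  -- polar coordinates of the traceless part of `N Nᵗ`
  let z : ℂ := ⟨(A - C) / 2, -B⟩
  have hz2 : ‖z‖ ^ 2 = ((A + C) / 2) ^ 2 - 1 := by
    rw [← Complex.normSq_eq_norm_sq, Complex.normSq_apply]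
    simp only [z]
    linear_combination -hABC
  have hcos : ‖z‖ * Real.cos (Complex.arg z) = (A - C) / 2 := Complex.norm_mul_cos_arg z
  have hsin : ‖z‖ * Real.sin (Complex.arg z) = -B := Complex.norm_mul_sin_arg z
  refine ⟨Real.arsinh ‖z‖ / 2, Complex.arg z / 2,
    div_nonneg (Real.arsinh_nonneg_iff.2 (norm_nonneg z)) two_pos.le, ?_⟩
  have hch : Real.cosh (Real.arsinh ‖z‖) = (A + C) / 2 := by
    rw [Real.cosh_arsinh, hz2, add_sub_cancel, Real.sqrt_sq (by linarith)]
  rw [IsRelativeSqueezing, ← hN, squeezeMat_transpose (Real.arsinh ‖z‖ / 2),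
    squeezeMat_mul_squeezeMat, add_halves, squeezeMat_eq, mul_div_cancel₀ _ two_ne_zero,
    Real.sinh_arsinh, hch, hcos, hsin]
  ext i j
  fin_cases i <;> fin_cases j <;>
    simp [Matrix.mul_apply, Fin.sum_univ_two, Matrix.transpose_apply, hA, hB, hC] <;> ring

end PhaseSpace

/-! ### Coinciding states and the minimum over `s` -/

section Minimum

variable {H : Type*} [NormedAddCommGroup H] [InnerProductSpace ℂ H] [CompleteSpace H]

/-- The squeezing operator depends on its parameters only through `r e^{2iθ}`. -/
theorem squeezeOp_congr (ket : HilbertBasis ℕ ℂ H) {r₀ θ₀ r₁ θ₁ : ℝ}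
    (h : (r₀ : ℂ) * Complex.exp (2 * θ₀ * Complex.I) = r₁ * Complex.exp (2 * θ₁ * Complex.I)) :
    squeezeOp ket r₀ θ₀ = squeezeOp ket r₁ θ₁ := by
  have h' := congrArg (starRingEnd ℂ) h
  rw [map_mul, map_mul, Complex.conj_ofReal, Complex.conj_ofReal, conj_exp_two_mul_I,
    conj_exp_two_mul_I] at h'
  have hK : squeezeGen r₀ θ₀ = squeezeGen r₁ θ₁ := by
    refine LinearMap.ext fun v => ?_
    simp only [squeezeGen, LinearMap.smul_apply, LinearMap.sub_apply, smul_sub, smul_smul]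
    push_cast
    rw [div_mul_eq_mul_div, div_mul_eq_mul_div, div_mul_eq_mul_div, div_mul_eq_mul_div, h, h']
  change opExp ket (squeezeGen r₀ θ₀) = opExp ket (squeezeGen r₁ θ₁)
  rw [hK]

theorem eq_of_coshSqR_eq_one {r₀ θ₀ r₁ θ₁ : ℝ} (h : coshSqR r₀ θ₀ r₁ θ₁ = 1) :
    (r₀ : ℂ) * Complex.exp (2 * θ₀ * Complex.I) = r₁ * Complex.exp (2 * θ₁ * Complex.I) := by
  have h1 := coshSqR_sub_one r₀ θ₀ r₁ θ₁
  rw [h, sub_self, eq_comm, Complex.normSq_eq_zero, sub_eq_zero] at h1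
  have h2 := congrArg Complex.normSq h1
  simp only [Complex.normSq_mul, Complex.normSq_conj, normSq_sqzCoeff, Complex.normSq_ofReal,
    ← pow_two, Real.cosh_sq] at h2
  have h3 : Real.sinh r₀ ^ 2 = Real.sinh r₁ ^ 2 := by linear_combination h2
  have h4 : Real.cosh r₀ = Real.cosh r₁ := by
    rw [← pow_left_inj₀ (Real.cosh_pos _).le (Real.cosh_pos _).le two_ne_zero, Real.cosh_sq,
      Real.cosh_sq, h3]
  have h5 : sqzCoeff r₀ θ₀ = sqzCoeff r₁ θ₁ := by
    have hne : ((Real.cosh r₁ : ℝ) : ℂ) ≠ 0 := Complex.ofReal_ne_zero.2 (Real.cosh_pos _).ne'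
    rw [h4, mul_comm] at h1
    exact (starRingEnd ℂ).injective (mul_left_cancel₀ hne h1)
  rw [sqzCoeff, sqzCoeff] at h5
  rcases eq_or_ne r₀ 0 with h0 | h0
  · subst h0
    have : r₁ = 0 := by
      rw [Real.sinh_zero, zero_pow two_ne_zero, eq_comm, sq_eq_zero_iff, Real.sinh_eq_zero] at h3
      exact h3
    subst this
    simp
  have hs : ((Real.sinh r₀ : ℝ) : ℂ) ≠ 0 := by
    rw [Complex.ofReal_ne_zero, Ne, Real.sinh_eq_zero]; exact h0
  rcases sq_eq_sq_iff_eq_or_eq_neg.1 h3 with h6 | h6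
  · have h7 := Real.sinh_injective h6
    subst h7
    rw [mul_right_cancel₀ hs h5]
  · rw [← Real.sinh_neg] at h6
    have h7 := Real.sinh_injective h6
    subst h7
    rw [Real.sinh_neg, Complex.ofReal_neg] at h5 hs
    have h8 : Complex.exp (2 * θ₀ * Complex.I) = -Complex.exp (2 * θ₁ * Complex.I) :=
      mul_right_cancel₀ hs (by linear_combination h5)
    rw [h8, Complex.ofReal_neg]
    ring

theorem skewness_half (β : ℝ) : skewness β (1 / 2) = 0 := by
  rw [skewness, show -β * (1 - 1 / 2) = -β * (1 / 2) by ring, sub_self, zero_div]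

theorem skewness_ne_zero {β s : ℝ} (hβ : 0 < β) (hs : s ≠ 1 / 2) : skewness β s ≠ 0 := by
  have h1 := Real.exp_lt_one_iff.2 (neg_neg_of_pos hβ)
  refine div_ne_zero (sub_ne_zero.2 fun h => hs ?_) (by linarith)
  have h2 := mul_left_cancel₀ (neg_ne_zero.2 hβ.ne') (Real.exp_injective h)
  linarith

theorem chernoffQ_gaussian (ket : HilbertBasis ℕ ℂ H) {β : ℝ} (hβ : 0 < β) (ξ : Fin 2 → ℝ)
    (r₀ θ₀ r₁ θ₁ : ℝ) {s : ℝ} (hs : s ∈ Set.Icc (0 : ℝ) 1) :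
    HasTrace (gaussianState ket β ξ r₀ θ₀ ^ s * gaussianState ket β ξ r₁ θ₁ ^ (1 - s))
      ((chernoffQ ket (gaussianState ket β ξ r₀ θ₀) (gaussianState ket β ξ r₁ θ₁) s : ℝ) : ℂ) ∧
    0 ≤ chernoffQ ket (gaussianState ket β ξ r₀ θ₀) (gaussianState ket β ξ r₁ θ₁) s ∧
    chernoffQ ket (gaussianState ket β ξ r₀ θ₀) (gaussianState ket β ξ r₁ θ₁) s ^ 2 *
      (coshSqR r₀ θ₀ r₁ θ₁ - (coshSqR r₀ θ₀ r₁ θ₁ - 1) * skewness β s ^ 2) = 1 := by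
  obtain ⟨q, h1, h2, h3⟩ := exists_hasTrace_gaussian ket hβ ξ r₀ θ₀ r₁ θ₁ hs
  rw [chernoffQ_eq_of_hasTrace h1]
  exact ⟨h1, h2, h3⟩

end Minimum

end

end GaussianChernoff

theorem mainTheorem7 {H : Type*} [NormedAddCommGroup H] [InnerProductSpace ℂ H]
    [CompleteSpace H] (ket : HilbertBasis ℕ ℂ H)
    (β : ℝ) (hβ : 0 < β) (ξ : Fin 2 → ℝ) (r₀ φ₀ r₁ φ₁ : ℝ)
    (ρ₀ ρ₁ : H →L[ℂ] H)
    (hρ₀ : ρ₀ = GaussianChernoff.gaussianState ket β ξ r₀ φ₀)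
    (hρ₁ : ρ₁ = GaussianChernoff.gaussianState ket β ξ r₁ φ₁) :
    -- `ρ₀^s ρ₁^{1-s}` is trace class with real trace `Q_s`
    (∀ s ∈ Set.Icc (0 : ℝ) 1, GaussianChernoff.HasTrace (ρ₀ ^ s * ρ₁ ^ (1 - s))
      ((GaussianChernoff.chernoffQ ket ρ₀ ρ₁ s : ℝ) : ℂ)) ∧
    -- `s = 1/2` is optimal, and it is the only optimal value if the states differ
    IsMinOn (GaussianChernoff.chernoffQ ket ρ₀ ρ₁) (Set.Icc 0 1) (1 / 2) ∧
    GaussianChernoff.quantumChernoff ket ρ₀ ρ₁ = GaussianChernoff.chernoffQ ket ρ₀ ρ₁ (1 / 2) ∧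
    (ρ₀ ≠ ρ₁ → ∀ s ∈ Set.Icc (0 : ℝ) 1, s ≠ 1 / 2 →
      GaussianChernoff.chernoffQ ket ρ₀ ρ₁ (1 / 2) < GaussianChernoff.chernoffQ ket ρ₀ ρ₁ s) ∧
    -- the value of `Q`, through `R` and explicitly
    (∃ R Φ : ℝ, 0 ≤ R ∧ GaussianChernoff.IsRelativeSqueezing r₀ φ₀ r₁ φ₁ R Φ) ∧
    (∀ R Φ : ℝ, GaussianChernoff.IsRelativeSqueezing r₀ φ₀ r₁ φ₁ R Φ →
      Real.cosh (2 * R) = Real.cos (φ₀ - φ₁) ^ 2 * Real.cosh (2 * (r₀ - r₁))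
        + Real.sin (φ₀ - φ₁) ^ 2 * Real.cosh (2 * (r₀ + r₁)) ∧
      GaussianChernoff.quantumChernoff ket ρ₀ ρ₁ = 1 / Real.cosh R) ∧
    GaussianChernoff.quantumChernoff ket ρ₀ ρ₁ =
      (Real.cosh (r₀ - r₁) ^ 2 + Real.sin (φ₀ - φ₁) ^ 2 * Real.sinh (2 * r₀) * Real.sinh (2 * r₁))
        ^ (-(1 / 2) : ℝ) := by
  have hQ := fun s hs =>
    GaussianChernoff.chernoffQ_gaussian ket hβ ξ r₀ φ₀ r₁ φ₁ (s := s) hs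
  rw [← hρ₀, ← hρ₁] at hQ
  have hP := GaussianChernoff.one_le_coshSqR r₀ φ₀ r₁ φ₁
  have hPeq := GaussianChernoff.coshSqR_eq r₀ φ₀ r₁ φ₁
  have hR := GaussianChernoff.two_mul_coshSqR_sub_one r₀ φ₀ r₁ φ₁
  set Q := GaussianChernoff.chernoffQ ket ρ₀ ρ₁ with hQdef
  set P := GaussianChernoff.coshSqR r₀ φ₀ r₁ φ₁ with hPdef
  have hmem : (1 / 2 : ℝ) ∈ Set.Icc (0 : ℝ) 1 := by constructor <;> norm_num
  obtain ⟨-, hq0, hq⟩ := hQ (1 / 2) hmem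
  rw [GaussianChernoff.skewness_half, zero_pow two_ne_zero, mul_zero, sub_zero] at hq
  have hle : ∀ s ∈ Set.Icc (0 : ℝ) 1, Q (1 / 2) ≤ Q s := by
    intro s hs
    obtain ⟨-, h0, h⟩ := hQ s hs
    refine (pow_le_pow_iff_left₀ hq0 h0 two_ne_zero).1 ?_
    nlinarith [mul_nonneg (mul_nonneg (sq_nonneg (Q s)) (sub_nonneg.2 hP))
      (sq_nonneg (GaussianChernoff.skewness β s))]
  have hmin : GaussianChernoff.quantumChernoff ket ρ₀ ρ₁ = Q (1 / 2) :=
    IsLeast.csInf_eq ⟨Set.mem_image_of_mem _ hmem, by rintro _ ⟨s, hs, rfl⟩; exact hle s hs⟩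
  refine ⟨fun s hs => (hQ s hs).1, fun s hs => hle s hs, hmin, fun hne s hs hs2 => ?_,
    GaussianChernoff.exists_isRelativeSqueezing r₀ φ₀ r₁ φ₁, fun R Φ h => ?_, ?_⟩
  -- `P = 1` would force equal squeezing, hence equal states; for `P > 1` the skewness term is
  -- strict away from `s = 1/2`
  · have hP1 : 1 < P := by
      refine lt_of_le_of_ne hP fun h => hne ?_
      rw [hρ₀, hρ₁, GaussianChernoff.gaussianState, GaussianChernoff.gaussianState,
        GaussianChernoff.squeezeOp_congr ket (GaussianChernoff.eq_of_coshSqR_eq_one h.symm)]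
    obtain ⟨-, h0, h⟩ := hQ s hs
    have hsk := sq_pos_of_ne_zero (GaussianChernoff.skewness_ne_zero hβ hs2)
    have hQs : 0 < Q s ^ 2 := by
      refine lt_of_le_of_ne (sq_nonneg _) fun h' => ?_
      rw [← h', zero_mul] at h
      exact zero_ne_one h
    refine (pow_lt_pow_iff_left₀ hq0 h0 two_ne_zero).1 ?_
    nlinarith [mul_pos (mul_pos hQs (sub_pos.2 hP1)) hsk]
  · have h2 := h.cosh_two_mul
    refine ⟨h2.trans hR, ?_⟩
    have hPR : P = Real.cosh R ^ 2 := by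
      rw [Real.cosh_two_mul, Real.sinh_sq] at h2
      linarith
    rw [hmin, eq_div_iff (Real.cosh_pos R).ne',
      ← pow_left_inj₀ (mul_nonneg hq0 (Real.cosh_pos R).le) zero_le_one two_ne_zero, mul_pow,
      ← hPR, hq, one_pow]
  · have hP0 : 0 ≤ P := by linarith
    rw [hmin, ← hPeq, Real.rpow_neg hP0, ← Real.sqrt_eq_rpow, ← one_div,
      eq_div_iff (Real.sqrt_pos.2 (by linarith)).ne',
      ← pow_left_inj₀ (mul_nonneg hq0 (Real.sqrt_nonneg P)) zero_le_one two_ne_zero, mul_pow,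
      Real.sq_sqrt hP0, hq, one_pow]
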